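/- Let $p_H:\mathbb{R}^n\to(0,\infty)$ be a probability density with $\int \|x\|^2 p_H(x)\,dx<\infty$ and $p_H\in C_b^2(\mathbb{R}^n)$, i.e. $p_H$ is $C^2$ and $p_H,\nabla p_H,\nabla^2p_H$ are bounded. Let $(X_t)_{t\ge 0}$ solve the variance-preserving SDE $$dX_t=-\tfrac12 X_t\,dt+dW_t,\qquad X_0\sim p_H,$$ where $W$ is a standard $n$-dimensional Brownian motion independent of $X_0$. Let $p_t$ be the (continuous) density of $X_t$, so that $p_0=p_H$, and let $s_t=\nabla\log p_t$ be the score. Suppose that there is a function $L:[0,\infty)\to[0,\infty)$ with $$\sup_{x\in\mathbb{R}^n}\|\nabla s_t(x)\|\le L(t)\ \text{ for all } t\ge 0,\qquad \int_0^T(1+L(t))\,dt<\infty\ \text{ for every } 0<T<\infty .$$ Then the probability flow ODE $$\frac{dx}{dt}=v_t(x),\qquad v_t(x)=-\tfrac12x-\tfrac12 s_t(x),$$ has for every $x\in\mathbb{R}^n$ a unique solution on $[0,\infty)$ starting from $x$ at time $0$. Let $\varphi_{0\to T}(x)$ denote the value of that solution at time $T$, and let $p_Z$ be the density of $\mathcal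 N(0,I_n)$. Then: I. For every $T>0$ the map $\varphi_{0\to T}:\mathbb{R}^n\to\mathbb{R}^n$ is a bi-Lipschitz $C^1$-diffeomorphism. II. The measure $(\varphi_{0\to T}^{-1})_\#p_Z$, which for each $T>0$ has a Lebesgue density (denoted in the same way), satisfies $$\lim_{T\to\infty}\mathrm{KL}\bigl(p_H\,\big\|\,(\varphi_{0\to T}^{-1})_\#p_Z\bigr)=0\qquad\text{and}\qquad \lim_{T\to\infty}\bigl\|p_H-(\varphi_{0\to T}^{-1})_\#p_Z\bigr\|_{L^1}=0 .$$ -/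

import Mathlib

open MeasureTheory ProbabilityTheory Set Filter
open scoped NNReal ENNReal Topology

namespace VPFlow

/-- The Euclidean space `ℝⁿ`. -/
abbrev E (n : ℕ) : Type := EuclideanSpace ℝ (Fin n)

/-- The measure with density `f` with respect to Lebesgue measure. -/
noncomputable def toMeasure {n : ℕ} (f : E n → ℝ) : Measure (E n) :=
  volume.withDensity fun x => ENNReal.ofReal (f x)

/-- Standard `n`-dimensional Brownian motion: the coordinates are independent real Brownian
motions (started at `0`, with almost surely continuous paths). -/
structure IsBrownian {n : ℕ} {Ω : Type*} [MeasurableSpace Ω]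
    (W : ℝ≥0 → Ω → E n) (P : Measure Ω) : Prop where
  coord : ∀ i, IsBrownianReal (fun t ω => W t ω i) P
  indep : iIndepFun (fun (i : Fin n) (ω : Ω) (t : ℝ≥0) => W t ω i) P

/-- The process `X` solves the variance-preserving stochastic differential equation
`dX_t = -(1/2) X_t dt + dW_t`, where `W` is a standard Brownian motion independent of `X_0`.
As the noise is additive with constant coefficient, the integrated form of the equation is
pathwise. -/
structure IsVPProcess {n : ℕ} {Ω : Type*} [MeasurableSpace Ω]
    (X W : ℝ≥0 → Ω → E n) (P : Measure Ω) : Prop where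
  brownian : IsBrownian W P
  aemeasurable : ∀ t, AEMeasurable (X t) P
  indep : IndepFun (X 0) (fun (ω : Ω) (t : ℝ≥0) => W t ω) P
  continuous : ∀ᵐ ω ∂P, Continuous fun t => X t ω
  sde : ∀ᵐ ω ∂P, ∀ t : ℝ≥0,
    X t ω = X 0 ω + (∫ s in (0 : ℝ)..t, (-(1 / 2 : ℝ)) • X s.toNNReal ω) + W t ω

/-- `f` is a continuous (nonnegative) Lebesgue density of `μ`. Such an `f` is unique. -/
def IsContDensity {n : ℕ} (μ : Measure (E n)) (f : E n → ℝ) : Prop :=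
  Continuous f ∧ (∀ x, 0 ≤ f x) ∧ μ = toMeasure f

open scoped Classical in
/-- The Lebesgue density of `μ`, as a function defined at every point: the continuous version
if there is one, and the Radon-Nikodym derivative otherwise. -/
noncomputable def density {n : ℕ} (μ : Measure (E n)) : E n → ℝ :=
  if h : ∃ f, IsContDensity μ f then h.choose else fun x => (μ.rnDeriv volume x).toReal

section marginals

variable {n : ℕ} {Ω : Type*} [MeasurableSpace Ω]

/-- The marginal density `p_t` of `X_t`, for `t ≥ 0`. -/
noncomputable def marginal (X : ℝ≥0 → Ω → E n) (P : Measure Ω) (t : ℝ) : E n → ℝ :=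
  density (P.map (X t.toNNReal))

/-- The score `s_t = ∇ log p_t`, for `t ≥ 0`. -/
noncomputable def score (X : ℝ≥0 → Ω → E n) (P : Measure Ω) (t : ℝ) (x : E n) : E n :=
  gradient (fun y => Real.log (marginal X P t y)) x

/-- The velocity field `v_t(x) = -x/2 - s_t(x)/2` of the probability flow, for `t ≥ 0`. -/
noncomputable def velocity (X : ℝ≥0 → Ω → E n) (P : Measure Ω) (t : ℝ) (x : E n) : E n :=
  -(1 / 2 : ℝ) • x - (1 / 2 : ℝ) • score X P t x

end marginals

/-- The class `C_b^k(ℝⁿ)`: `C^k` functions whose derivatives of orders `0, …, k` are bounded. -/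
def MemCb {n : ℕ} (k : ℕ) (f : E n → ℝ) : Prop :=
  ContDiff ℝ k f ∧ ∀ j ≤ k, ∃ C : ℝ, ∀ x, ‖iteratedFDeriv ℝ j f x‖ ≤ C

/-- `φ t x` is the value at time `t ≥ 0` of the solution of `dx/dt = v t x` which starts from
`x` at time `0`; solutions exist for all times and are unique. Thus `φ t` is the transport map
from time `0` to time `t`. -/
structure IsFlowFromZero {n : ℕ} (v : ℝ → E n → E n) (φ : ℝ → E n → E n) : Prop where
  init : ∀ x, φ 0 x = x
  ode : ∀ x, IsIntegralCurveOn (fun t => φ t x) v (Ici 0)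
  unique : ∀ T > 0, ∀ γ : ℝ → E n, IsIntegralCurveOn γ v (Icc 0 T) →
    ∀ t ∈ Icc 0 T, γ t = φ t (γ 0)

/-- Bi-Lipschitz maps of `ℝⁿ`. -/
def IsBiLipschitz {n : ℕ} (f : E n → E n) : Prop :=
  ∃ c C : ℝ, 0 < c ∧ c ≤ C ∧ ∀ x y, c * ‖x - y‖ ≤ ‖f x - f y‖ ∧ ‖f x - f y‖ ≤ C * ‖x - y‖

/-- `C¹`-diffeomorphisms of `ℝⁿ` onto itself. -/
def IsC1Diffeo {n : ℕ} (f : E n → E n) : Prop :=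
  Function.Bijective f ∧ ContDiff ℝ 1 f ∧ ContDiff ℝ 1 (Function.invFun f)

/-- The pushforward `(f⁻¹)_# p_Z` of the standard Gaussian measure under the inverse of a
bijection `f`. -/
noncomputable def gaussianPullback {n : ℕ} (f : E n → E n) : Measure (E n) :=
  (stdGaussian (E n)).map (Function.invFun f)

end VPFlow

/-! The law of `X t` is explicit: it is the law of `exp (-t / 2) • (X 0 + noiseScale t • Z)` with
`Z` standard Gaussian and independent of `X 0` (`map_eq_map_prod`). Its density is therefore a
rescaled Gaussian average of the initial density, `heatDensity`. Since all spatial derivatives can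
be put on the initial density instead of the Gaussian kernel, the density, its score and the
Jacobian of the score are jointly continuous up to time `0`.

The bound on the Jacobian of the score makes the velocity globally Lipschitz in space with a locally
integrable constant. This yields global solutions and the two-sided bound `exp (± ∫ k)` on the
separation of trajectories. Joint continuity of the Jacobian makes the flow maps `C¹`, with
derivative solving the variational equation. The Fokker-Planck equation along trajectories and
Liouville's formula for the Jacobian determinant cancel, so `p_T (φ_T x) * det (Dφ_T x) = p_H x`
(`IsCb2.heatDensity_flow_mul_det`). Positivity of `p_H` then gives an invertible derivative, hence a
diffeomorphism, and the identity says that `φ_T` pushes `p_H` to `p_T`.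

Consequently `p_H` and the pulled back Gaussian are the images of `p_T` and of the Gaussian under
one map, and data processing bounds their divergence by that of `p_T` from the Gaussian. A second
use of data processing, on the pair (initial point, endpoint), bounds the latter by an explicit
Gaussian expression which needs only the second moment (`klDiv_map_prod_stdGaussian_le`) and tends
to `0`. A Pinsker-type inequality (`abs_sub_one_le_klFun`) turns this into `L¹` convergence. -/

namespace VPFlow

set_option linter.unusedSectionVars false

/-! ### Flows of vector fields with locally integrable Lipschitz constant -/

section ODE

/-- A function whose logarithmic derivative is dominated by `κ` changes at most by the factor
`exp (∫ κ)`. -/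
lemma abs_log_sub_log_le_integral {u u' κ : ℝ → ℝ} {a b : ℝ} (hab : a ≤ b)
    (hu : ∀ t ∈ Icc a b, HasDerivAt u (u' t) t) (hu' : ContinuousOn u' (Icc a b))
    (hpos : ∀ t ∈ Icc a b, 0 < u t) (hκ : IntervalIntegrable κ volume a b)
    (hle : ∀ t ∈ Icc a b, |u' t| ≤ κ t * u t) :
    |Real.log (u b) - Real.log (u a)| ≤ ∫ t in a..b, κ t := by
  have hcont : ContinuousOn u (Icc a b) := fun t ht => (hu t ht).continuousAt.continuousWithinAt
  have h1 : ∀ t ∈ Icc a b, HasDerivAt (fun t => Real.log (u t)) (u' t / u t) t := fun t ht =>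
    (hu t ht).log (hpos t ht).ne'
  have hc : ContinuousOn (fun t => u' t / u t) (Icc a b) :=
    hu'.div hcont fun t ht => (hpos t ht).ne'
  have h2 := intervalIntegral.integral_eq_sub_of_hasDerivAt_of_le hab
    (fun t ht => (h1 t ht).continuousAt.continuousWithinAt)
    (fun t ht => h1 t (Ioo_subset_Icc_self ht)) (hc.intervalIntegrable_of_Icc hab)
  rw [← h2, ← Real.norm_eq_abs]
  refine intervalIntegral.norm_integral_le_of_norm_le hab (ae_of_all _ fun t ht => ?_) hκ
  have ht' := Ioc_subset_Icc_self ht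
  rw [Real.norm_eq_abs, abs_div, abs_of_pos (hpos t ht'), div_le_iff₀ (hpos t ht')]
  exact hle t ht'

variable {F : Type*} [NormedAddCommGroup F] [InnerProductSpace ℝ F] [FiniteDimensional ℝ F]

/-- Time-dependent vector fields which are `C¹` in space, with spatial derivative continuous in
time and space and bounded by a locally integrable function of time. -/
structure IsC1Field (V : ℝ → F → F) (DV : ℝ → F → F →L[ℝ] F) (k : ℝ → ℝ) : Prop where
  continuous : Continuous (Function.uncurry V)
  hasFDerivAt : ∀ t x, HasFDerivAt (V t) (DV t x) x
  continuous_deriv : Continuous (Function.uncurry DV)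
  norm_le : ∀ t x, ‖DV t x‖ ≤ k t
  integrable : ∀ a b, IntervalIntegrable k volume a b

variable {V : ℝ → F → F} {DV : ℝ → F → F →L[ℝ] F} {k : ℝ → ℝ}

namespace IsC1Field

lemma nonneg (h : IsC1Field V DV k) (t : ℝ) : 0 ≤ k t := (norm_nonneg _).trans (h.norm_le t 0)

lemma norm_sub_le (h : IsC1Field V DV k) (t : ℝ) (x y : F) :
    ‖V t x - V t y‖ ≤ k t * ‖x - y‖ :=
  convex_univ.norm_image_sub_le_of_norm_hasFDerivWithin_le
    (fun z _ => (h.hasFDerivAt t z).hasFDerivWithinAt) (fun z _ => h.norm_le t z)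
    (mem_univ y) (mem_univ x)

lemma comp_add (h : IsC1Field V DV k) (s : ℝ) :
    IsC1Field (fun t => V (t + s)) (fun t => DV (t + s)) (fun t => k (t + s)) where
  continuous := h.continuous.comp (f := fun p : ℝ × F => (p.1 + s, p.2)) (by fun_prop)
  hasFDerivAt t x := h.hasFDerivAt _ x
  continuous_deriv := h.continuous_deriv.comp (f := fun p : ℝ × F => (p.1 + s, p.2)) (by fun_prop)
  norm_le t x := h.norm_le _ x
  integrable a b := by
    simpa using (h.integrable (a + s) (b + s)).comp_add_right s

/-- As `k` is merely integrable, it may be unbounded on a compact time interval. A Lipschitz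
constant uniform in time comes instead from continuity of `DV` on a compact set, at the price of
restricting to a ball. -/
lemma exists_lipschitzOnWith (h : IsC1Field V DV k) (a b R : ℝ) :
    ∃ K : ℝ≥0, ∀ t ∈ Icc a b, LipschitzOnWith K (V t) (Metric.closedBall 0 R) := by
  obtain ⟨C, hC⟩ := (isCompact_Icc.prod (isCompact_closedBall (0 : F) R)).exists_bound_of_continuousOn
    (s := Icc a b ×ˢ Metric.closedBall (0 : F) R) h.continuous_deriv.continuousOn
  refine ⟨C.toNNReal, fun t ht => (convex_closedBall 0 R).lipschitzOnWith_of_nnnorm_hasFDerivWithin_le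
    (fun x _ => (h.hasFDerivAt t x).hasFDerivWithinAt) fun x hx => ?_⟩
  rw [← NNReal.coe_le_coe, coe_nnnorm]
  exact (hC (t, x) ⟨ht, hx⟩).trans (Real.le_coe_toNNReal C)

/-- By compactness both curves stay in one ball, on which the local Lipschitz constant applies. The
curves are only assumed to solve the equation on the closed interval, with one-sided derivatives at
its ends. -/
lemma eqOn_Icc (h : IsC1Field V DV k) {γ₁ γ₂ : ℝ → F} {a b : ℝ}
    (h₁ : IsIntegralCurveOn γ₁ V (Icc a b)) (h₂ : IsIntegralCurveOn γ₂ V (Icc a b))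
    (heq : γ₁ a = γ₂ a) : EqOn γ₁ γ₂ (Icc a b) := by
  obtain ⟨C₁, hC₁⟩ := isCompact_Icc.exists_bound_of_continuousOn h₁.continuousOn
  obtain ⟨C₂, hC₂⟩ := isCompact_Icc.exists_bound_of_continuousOn h₂.continuousOn
  obtain ⟨K, hK⟩ := h.exists_lipschitzOnWith a b (max C₁ C₂)
  have hd : ∀ γ : ℝ → F, IsIntegralCurveOn γ V (Icc a b) → ∀ t ∈ Ico a b,
      HasDerivWithinAt γ (V t (γ t)) (Ici t) t := fun γ hγ t ht =>
    (hγ t (Ico_subset_Icc_self ht)).mono_of_mem_nhdsWithin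
      (mem_of_superset (Icc_mem_nhdsGE ht.2) (Icc_subset_Icc_left ht.1))
  refine ODE_solution_unique_of_mem_Icc_right (s := fun _ => Metric.closedBall 0 (max C₁ C₂))
    (fun t ht => hK t (Ico_subset_Icc_self ht)) h₁.continuousOn (hd _ h₁) (fun t ht => ?_)
    h₂.continuousOn (hd _ h₂) (fun t ht => ?_) heq
  · simpa using Or.inl (hC₁ t (Ico_subset_Icc_self ht))
  · simpa using Or.inr (hC₂ t (Ico_subset_Icc_self ht))

lemma eq_of_isIntegralCurve (h : IsC1Field V DV k) {γ₁ γ₂ : ℝ → F}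
    (h₁ : IsIntegralCurve γ₁ V) (h₂ : IsIntegralCurve γ₂ V) {s : ℝ} (heq : γ₁ s = γ₂ s) :
    γ₁ = γ₂ := by
  ext t
  set a := min s t - 1
  set b := max s t + 1
  obtain ⟨C₁, hC₁⟩ := (isCompact_Icc (a := a) (b := b)).exists_bound_of_continuousOn
    h₁.continuous.continuousOn
  obtain ⟨C₂, hC₂⟩ := (isCompact_Icc (a := a) (b := b)).exists_bound_of_continuousOn
    h₂.continuous.continuousOn
  obtain ⟨K, hK⟩ := h.exists_lipschitzOnWith a b (max C₁ C₂)
  refine ODE_solution_unique_of_mem_Ioo (s := fun _ => Metric.closedBall 0 (max C₁ C₂))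
    (fun t ht => hK t (Ioo_subset_Icc_self ht)) (t₀ := s) (a := a) (b := b) ?_
    (fun t ht => ⟨h₁ t, ?_⟩) (fun t ht => ⟨h₂ t, ?_⟩) heq ?_
  · constructor
    · linarith [min_le_left s t]
    · linarith [le_max_left s t]
  · simpa using Or.inl (hC₁ t (Ioo_subset_Icc_self ht))
  · simpa using Or.inr (hC₂ t (Ioo_subset_Icc_self ht))
  · constructor
    · linarith [min_le_right s t]
    · linarith [le_max_right s t]

/-- Two integral curves separate or approach each other at most by the factor `exp (∫ k)`. -/
lemma norm_sub_le_exp_mul (h : IsC1Field V DV k) {γ₁ γ₂ : ℝ → F} (h₁ : IsIntegralCurve γ₁ V)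
    (h₂ : IsIntegralCurve γ₂ V) {a b : ℝ} (hab : a ≤ b) :
    ‖γ₁ b - γ₂ b‖ ≤ Real.exp (∫ t in a..b, k t) * ‖γ₁ a - γ₂ a‖ ∧
    ‖γ₁ a - γ₂ a‖ ≤ Real.exp (∫ t in a..b, k t) * ‖γ₁ b - γ₂ b‖ := by
  by_cases heq : γ₁ a = γ₂ a
  · simp [h.eq_of_isIntegralCurve h₁ h₂ heq]
  -- Distinct trajectories never meet, so the logarithm of the squared distance is differentiable;
  -- its derivative is at most `2 * k` in absolute value, which gives both inequalities at once.
  have hne : ∀ t, γ₁ t - γ₂ t ≠ 0 := fun t ht =>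
    heq (congrFun (h.eq_of_isIntegralCurve h₁ h₂ (sub_eq_zero.1 ht)) a)
  have hVc : ∀ γ, IsIntegralCurve γ V → Continuous fun t => V t (γ t) := fun γ hγ =>
    h.continuous.comp (continuous_id.prodMk hγ.continuous)
  have hmain := abs_log_sub_log_le_integral (κ := fun t => 2 * k t) hab
    (u := fun t => ‖γ₁ t - γ₂ t‖ ^ 2)
    (u' := fun t => 2 * inner ℝ (γ₁ t - γ₂ t) (V t (γ₁ t) - V t (γ₂ t)))
    (fun t _ => ((h₁ t).sub (h₂ t)).norm_sq)
    (((h₁.continuous.sub h₂.continuous).inner ((hVc _ h₁).sub (hVc _ h₂))).const_mul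
      2).continuousOn
    (fun t _ => by have := norm_pos_iff.2 (hne t); positivity)
    ((h.integrable a b).const_mul 2) (fun t _ => ?_)
  · have hp : ∀ t, 0 < ‖γ₁ t - γ₂ t‖ := fun t => norm_pos_iff.2 (hne t)
    rw [intervalIntegral.integral_const_mul, Real.log_pow, Real.log_pow, abs_le] at hmain
    push_cast at hmain
    constructor
    · rw [← Real.log_le_log_iff (hp b) (by have := hp a; positivity),
        Real.log_mul (Real.exp_pos _).ne' (hp a).ne', Real.log_exp]
      linarith [hmain.2]
    · rw [← Real.log_le_log_iff (hp a) (by have := hp b; positivity),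
        Real.log_mul (Real.exp_pos _).ne' (hp b).ne', Real.log_exp]
      linarith [hmain.1]
  · rw [abs_mul, abs_two, mul_assoc, sq, ← mul_assoc (k t), mul_comm (k t), mul_assoc]
    gcongr
    exact (abs_real_inner_le_norm _ _).trans (by gcongr; exact h.norm_sub_le t _ _)

end IsC1Field

/-- A vector field which coincides with `V` on the ball of radius `R`, is bounded by it in norm,
and is bounded and Lipschitz in space on compact time intervals. -/
lemma IsC1Field.exists_cutoff (h : IsC1Field V DV k) (a b : ℝ) {R : ℝ} (hR : 0 < R) :
    ∃ U : ℝ → F → F, Continuous (Function.uncurry U) ∧ (∀ t, ∀ x, ‖x‖ ≤ R → U t x = V t x) ∧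
      (∀ t x, ‖U t x‖ ≤ ‖V t x‖) ∧ (∃ K : ℝ≥0, ∀ t ∈ Icc a b, LipschitzWith K (U t)) ∧
      ∃ C : ℝ≥0, ∀ t ∈ Icc a b, ∀ x, ‖U t x‖ ≤ C := by
  let χ : ContDiffBump (0 : F) := ⟨R, 2 * R, hR, by linarith⟩
  have hχ : ContDiff ℝ 1 (χ : F → ℝ) := χ.contDiff
  have hχc : Continuous (χ : F → ℝ) := χ.continuous
  have hχd : Continuous (fderiv ℝ (χ : F → ℝ)) := hχ.continuous_fderiv one_ne_zero
  have hzero : ∀ x : F, x ∉ Metric.closedBall (0 : F) (2 * R) → χ x = 0 := fun x hx =>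
    χ.zero_of_le_dist (by simpa using (not_le.1 (by simpa using hx)).le)
  have hderiv : ∀ t x, HasFDerivAt (fun x => χ x • V t x)
      (χ x • DV t x + (fderiv ℝ χ x).smulRight (V t x)) x := fun t x =>
    ((hχ.differentiable one_ne_zero) x).hasFDerivAt.smul (h.hasFDerivAt t x)
  have hc : Continuous (fun p : ℝ × F => χ p.2 • V p.1 p.2) :=
    (hχc.comp continuous_snd).smul h.continuous
  have hdc : Continuous (fun p : ℝ × F =>
      χ p.2 • DV p.1 p.2 + (fderiv ℝ χ p.2).smulRight (V p.1 p.2)) := by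
    refine ((hχc.comp continuous_snd).smul h.continuous_deriv).add ?_
    exact (ContinuousLinearMap.smulRightL ℝ F F).continuous₂.comp
      ((hχd.comp continuous_snd).prodMk h.continuous)
  obtain ⟨K, hK⟩ := (isCompact_Icc.prod (isCompact_closedBall (0 : F) (2 * R))).exists_bound_of_continuousOn
    (s := Icc a b ×ˢ Metric.closedBall (0 : F) (2 * R)) hdc.continuousOn
  obtain ⟨C, hC⟩ := (isCompact_Icc.prod (isCompact_closedBall (0 : F) (2 * R))).exists_bound_of_continuousOn
    (s := Icc a b ×ˢ Metric.closedBall (0 : F) (2 * R)) hc.continuousOn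
  refine ⟨fun t x => χ x • V t x, hc, fun t x hx => ?_, fun t x => ?_, ⟨K.toNNReal, fun t ht => ?_⟩,
    C.toNNReal, fun t ht x => ?_⟩
  · change χ x • V t x = V t x
    rw [χ.one_of_mem_closedBall (by simpa [χ] using hx), one_smul]
  · change ‖χ x • V t x‖ ≤ ‖V t x‖
    rw [norm_smul, Real.norm_of_nonneg χ.nonneg]
    exact mul_le_of_le_one_left (norm_nonneg _) χ.le_one
  · refine lipschitzWith_of_nnnorm_fderiv_le (𝕜 := ℝ) (fun x => (hderiv t x).differentiableAt)
      fun x => ?_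
    rw [← NNReal.coe_le_coe, coe_nnnorm]
    by_cases hx : x ∈ Metric.closedBall (0 : F) (2 * R)
    · rw [(hderiv t x).fderiv]
      exact (hK (t, x) ⟨ht, hx⟩).trans (Real.le_coe_toNNReal K)
    -- Off the closed ball of radius `2 * R` the product vanishes on a neighbourhood, so the bound
    -- on the compact ball is a global one.
    · have : (fun x => χ x • V t x) =ᶠ[𝓝 x] fun _ => 0 := by
        filter_upwards [Metric.isClosed_closedBall.isOpen_compl.mem_nhds hx] with y hy
        rw [hzero y hy, zero_smul]
      rw [this.fderiv_eq]
      simp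
  · by_cases hx : x ∈ Metric.closedBall (0 : F) (2 * R)
    · exact (hC (t, x) ⟨ht, hx⟩).trans (Real.le_coe_toNNReal C)
    · simp [hzero x hx]

/-- Curves with at most linear growth of the velocity, with locally integrable coefficient, stay
bounded on bounded intervals. -/
lemma norm_sq_le_of_linear_growth {γ γ' : ℝ → F} {m : ℝ} {κ : ℝ → ℝ} {a b : ℝ}
    (hγ : ∀ t ∈ Icc a b, HasDerivAt γ (γ' t) t) (hγ' : ContinuousOn γ' (Icc a b))
    (hκ : IntervalIntegrable κ volume a b) (hκ0 : ∀ t, 0 ≤ κ t) (hm : 0 ≤ m)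
    (hle : ∀ t ∈ Icc a b, ‖γ' t‖ ≤ m + κ t * ‖γ t‖) {s t : ℝ} (hs : s ∈ Icc a b)
    (ht : t ∈ Icc a b) :
    ‖γ t‖ ^ 2 ≤ (1 + ‖γ s‖ ^ 2) * Real.exp (∫ τ in a..b, (m + 2 * κ τ)) := by
  have hgc : ContinuousOn γ (Icc a b) := fun t ht => (hγ t ht).continuousAt.continuousWithinAt
  have hint : IntervalIntegrable (fun τ => m + 2 * κ τ) volume a b :=
    intervalIntegrable_const.add (hκ.const_mul 2)
  have key : ∀ c ∈ Icc a b, ∀ d ∈ Icc a b, c ≤ d →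
      |Real.log (1 + ‖γ d‖ ^ 2) - Real.log (1 + ‖γ c‖ ^ 2)| ≤ ∫ τ in a..b, (m + 2 * κ τ) := by
    intro c hc d hd hcd
    have hsub : Icc c d ⊆ Icc a b := Icc_subset_Icc hc.1 hd.2
    refine (abs_log_sub_log_le_integral (κ := fun τ => m + 2 * κ τ) hcd
      (u := fun t => 1 + ‖γ t‖ ^ 2) (u' := fun t => 2 * inner ℝ (γ t) (γ' t))
      (fun t ht => ((hγ t (hsub ht)).norm_sq).const_add 1)
      (((hgc.mono hsub).inner (hγ'.mono hsub)).const_mul 2)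
      (fun t _ => by positivity)
      (hint.mono_set (by rw [uIcc_of_le hcd, uIcc_of_le (hc.1.trans hc.2)]; exact hsub))
      (fun t ht => ?_)).trans ?_
    · rw [abs_mul, abs_two]
      have h1 := (abs_real_inner_le_norm (γ t) (γ' t)).trans
        (mul_le_mul_of_nonneg_left (hle t (hsub ht)) (norm_nonneg _))
      -- With `r = ‖γ t‖`, the inequality `2 * r ≤ 1 + r ^ 2` gives `2 * r * (m + κ * r) ≤ (m + 2 *
      -- κ) * (1 + r ^ 2)`.
      nlinarith [mul_nonneg hm (sq_nonneg (‖γ t‖ - 1)), hκ0 t]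
    · refine intervalIntegral.integral_mono_interval hc.1 hcd hd.2 ?_ hint
      exact ae_of_all _ fun τ => by have := hκ0 τ; simp only [Pi.zero_apply]; positivity
  have h3 : Real.log (1 + ‖γ t‖ ^ 2) - Real.log (1 + ‖γ s‖ ^ 2) ≤ ∫ τ in a..b, (m + 2 * κ τ) := by
    rcases le_total s t with hst | hst
    · exact (abs_le.1 (key s hs t ht hst)).2
    · have := (abs_le.1 (key t ht s hs hst)).1
      linarith
  have h4 : 1 + ‖γ t‖ ^ 2 ≤ (1 + ‖γ s‖ ^ 2) * Real.exp (∫ τ in a..b, (m + 2 * κ τ)) := by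
    rw [← Real.log_le_log_iff (by positivity) (by positivity),
      Real.log_mul (by positivity) (by positivity), Real.log_exp]
    linarith
  linarith

namespace IsC1Field

/-- Picard-Lindelöf solves the equation for a truncated field over the whole interval. Truncation
does not increase the norm of the field, so the a priori growth bound for `V` confines this solution
to the ball where nothing was truncated. -/
lemma exists_isIntegralCurve_Icc (h : IsC1Field V DV k) (x : F) {N : ℝ} (hN : 0 < N) :
    ∃ γ : ℝ → F, γ 0 = x ∧ ∀ t ∈ Icc (-N) N, HasDerivAt γ (V t (γ t)) t := by
  obtain ⟨m, hm⟩ := (isCompact_Icc (a := -N) (b := N)).exists_bound_of_continuousOn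
    (f := fun t => V t 0)
    (h.continuous.comp (continuous_id.prodMk continuous_const)).continuousOn
  have hm0 : 0 ≤ m := (norm_nonneg _).trans (hm 0 ⟨by linarith, hN.le⟩)
  -- The bound depends only on the linear growth of `V`, so the cutoff radius `√B` can be fixed
  -- before the curve is known. The slightly larger time interval `N + 1` used below gives two-sided
  -- derivatives at `±N`.
  set B := (1 + ‖x‖ ^ 2) * Real.exp (∫ τ in (-N)..N, (m + 2 * k τ)) with hB
  have hBpos : 0 < B := by positivity
  obtain ⟨U, hUc, hUV, hUle, ⟨K, hK⟩, C, hC⟩ :=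
    h.exists_cutoff (-(N + 1)) (N + 1) (Real.sqrt_pos.2 hBpos)
  have hpl : IsPicardLindelof U (tmin := -(N + 1)) (tmax := N + 1)
      ⟨0, by constructor <;> linarith⟩ x (C * (N + 1).toNNReal) 0 C K :=
    { lipschitzOnWith := fun t ht => (hK t ht).lipschitzOnWith
      continuousOn := fun x _ =>
        (hUc.comp (continuous_id.prodMk continuous_const)).continuousOn
      norm_le := fun t ht x _ => hC t ht x
      mul_max_le := by
        simp [Real.coe_toNNReal (N + 1) (by linarith)] }
  obtain ⟨γ, hγ0, hγ⟩ := hpl.exists_eq_forall_mem_Icc_hasDerivWithinAt₀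
  have hd : ∀ t ∈ Icc (-N) N, HasDerivAt γ (U t (γ t)) t := fun t ht =>
    (hγ t ⟨by linarith [ht.1], by linarith [ht.2]⟩).hasDerivAt
      (Icc_mem_nhds (by linarith [ht.1]) (by linarith [ht.2]))
  have hgc : ContinuousOn γ (Icc (-N) N) := fun t ht =>
    (hd t ht).continuousAt.continuousWithinAt
  refine ⟨γ, hγ0, fun t ht => ?_⟩
  rw [← hUV t (γ t)]
  · exact hd t ht
  · refine Real.le_sqrt_of_sq_le ?_
    have := norm_sq_le_of_linear_growth hd
      (hUc.comp_continuousOn (continuousOn_id.prodMk hgc)) (h.integrable (-N) N) h.nonneg hm0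
      (fun t ht => ?_) (s := 0) ⟨by linarith, hN.le⟩ ht
    · rwa [show γ 0 = x from hγ0] at this
    · calc ‖U t (γ t)‖ ≤ ‖V t (γ t)‖ := hUle _ _
        _ ≤ ‖V t 0‖ + ‖V t (γ t) - V t 0‖ := norm_le_norm_add_norm_sub' _ _
        _ ≤ m + k t * ‖γ t‖ := by
          gcongr
          · exact hm t ht
          · simpa using h.norm_sub_le t (γ t) 0

lemma exists_isIntegralCurve_zero (h : IsC1Field V DV k) (x : F) :
    ∃ γ : ℝ → F, γ 0 = x ∧ IsIntegralCurve γ V := by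
  choose γ hγ0 hγ using fun N : ℕ => h.exists_isIntegralCurve_Icc x (N := N + 1) (by positivity)
  -- Uniqueness was proved forward from the left endpoint; the time-reversed field transfers it to
  -- negative times.
  have hneg : IsC1Field (fun t x => -V (-t) x) (fun t x => -DV (-t) x) (fun t => k (-t)) :=
    { continuous := (h.continuous.comp
        (f := fun p : ℝ × F => (-p.1, p.2)) (by fun_prop)).neg
      hasFDerivAt := fun t x => (h.hasFDerivAt _ x).neg
      continuous_deriv := (h.continuous_deriv.comp
        (f := fun p : ℝ × F => (-p.1, p.2)) (by fun_prop)).neg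
      norm_le := fun t x => by rw [norm_neg]; exact h.norm_le _ x
      integrable := fun a b => by
        have := (h.integrable (-a) (-b)).comp_mul_left (c := -1)
        simpa using this }
  have heq : ∀ M N : ℕ, M ≤ N → EqOn (γ M) (γ N) (Icc (-(M + 1 : ℝ)) (M + 1)) := by
    intro M N hMN t ht
    have hMN' : (M : ℝ) ≤ N := by exact_mod_cast hMN
    rcases le_total 0 t with h0 | h0
    · refine h.eqOn_Icc (a := 0) (b := M + 1) (fun τ hτ => ?_) (fun τ hτ => ?_)
        ((hγ0 M).trans (hγ0 N).symm) ⟨h0, ht.2⟩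
      · exact (hγ M τ ⟨by linarith [hτ.1], hτ.2⟩).hasDerivWithinAt
      · exact (hγ N τ ⟨by linarith [hτ.1], by linarith [hτ.2]⟩).hasDerivWithinAt
    · have hrev : ∀ N' : ℕ, M ≤ N' → IsIntegralCurveOn (fun τ => γ N' (-τ)) (fun t x => -V (-t) x)
          (Icc 0 (M + 1)) := by
        intro N' hN' τ hτ
        have hN'' : (M : ℝ) ≤ N' := by exact_mod_cast hN'
        have := (hγ N' (-τ) ⟨by linarith [hτ.2], by linarith [hτ.1]⟩).scomp τ
          (hasDerivAt_neg τ)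
        simpa using! this.hasDerivWithinAt
      have := hneg.eqOn_Icc (hrev M le_rfl) (hrev N hMN)
        (by simpa using (hγ0 M).trans (hγ0 N).symm) (x := -t) ⟨by linarith, by linarith [ht.1]⟩
      simpa using this
  -- Gluing: the curve with index `⌈|t|⌉₊` solves the equation up to `|t| ≤ ⌈|t|⌉₊ + 1`, which
  -- leaves a full neighbourhood of `t`.
  refine ⟨fun t => γ ⌈|t|⌉₊ t, by simpa using hγ0 _, fun t => ?_⟩
  set N : ℕ := ⌈|t|⌉₊
  have hN : |t| ≤ N := Nat.le_ceil _
  have hev : (fun t => γ ⌈|t|⌉₊ t) =ᶠ[𝓝 t] γ N := by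
    have : ∀ᶠ τ in 𝓝 t, |τ| < (N : ℝ) + 1 :=
      (continuous_abs.tendsto t).eventually (gt_mem_nhds (by linarith))
    filter_upwards [this] with τ hτ
    rcases le_total ⌈|τ|⌉₊ N with hle | hle
    · refine heq _ _ hle (abs_le.1 ?_)
      have := Nat.le_ceil |τ|
      linarith
    · exact (heq _ _ hle (abs_le.1 hτ.le)).symm
  exact (hγ N t (abs_le.1 (by linarith))).congr_of_eventuallyEq hev

lemma exists_isIntegralCurve (h : IsC1Field V DV k) (s : ℝ) (x : F) :
    ∃ γ : ℝ → F, γ s = x ∧ IsIntegralCurve γ V := by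
  obtain ⟨γ, h0, hγ⟩ := (h.comp_add s).exists_isIntegralCurve_zero x
  refine ⟨fun t => γ (t - s), by simpa using h0, ?_⟩
  have := hγ.comp_add (-s)
  simpa [Function.comp_def, sub_eq_add_neg] using! this

/-- The value at time `t` of the integral curve which passes through `x` at time `s`. -/
noncomputable def flow (h : IsC1Field V DV k) (s t : ℝ) (x : F) : F :=
  (h.exists_isIntegralCurve s x).choose t

lemma flow_self (h : IsC1Field V DV k) (s : ℝ) (x : F) : h.flow s s x = x :=
  (h.exists_isIntegralCurve s x).choose_spec.1

lemma isIntegralCurve_flow (h : IsC1Field V DV k) (s : ℝ) (x : F) :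
    IsIntegralCurve (fun t => h.flow s t x) V :=
  (h.exists_isIntegralCurve s x).choose_spec.2

lemma flow_flow (h : IsC1Field V DV k) (r s t : ℝ) (x : F) :
    h.flow s t (h.flow r s x) = h.flow r t x :=
  congrFun (h.eq_of_isIntegralCurve (h.isIntegralCurve_flow s _) (h.isIntegralCurve_flow r x)
    (h.flow_self s _)) t

lemma continuous_flow (h : IsC1Field V DV k) {s t : ℝ} : Continuous (h.flow s t) := by
  have : LipschitzWith (Real.exp (∫ τ in (min s t)..(max s t), k τ)).toNNReal (h.flow s t) := by
    refine LipschitzWith.of_dist_le_mul fun x y => ?_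
    rw [dist_eq_norm, dist_eq_norm, Real.coe_toNNReal _ (Real.exp_pos _).le]
    have := h.norm_sub_le_exp_mul (h.isIntegralCurve_flow s x) (h.isIntegralCurve_flow s y)
      (min_le_max (a := s) (b := t))
    rcases le_total s t with hst | hst
    · simpa [hst, h.flow_self] using this.1
    · simpa [hst, h.flow_self] using this.2
  exact this.continuous

/-- The flow map from time `s` to time `t`. -/
noncomputable def flowHomeomorph (h : IsC1Field V DV k) (s t : ℝ) : F ≃ₜ F where
  toFun := h.flow s t
  invFun := h.flow t s
  left_inv x := by rw [h.flow_flow, h.flow_self]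
  right_inv x := by rw [h.flow_flow, h.flow_self]
  continuous_toFun := h.continuous_flow
  continuous_invFun := h.continuous_flow

/-- The field which governs the variation of the integral curve `γ`. -/
lemma variational (h : IsC1Field V DV k) {γ : ℝ → F} (hγ : Continuous γ) :
    IsC1Field (fun t y => DV t (γ t) y) (fun t _ => DV t (γ t)) k where
  continuous := (h.continuous_deriv.comp (f := fun p : ℝ × F => (p.1, γ p.1))
    (by fun_prop)).clm_apply continuous_snd
  hasFDerivAt t _ := (DV t (γ t)).hasFDerivAt
  continuous_deriv := h.continuous_deriv.comp (f := fun p : ℝ × F => (p.1, γ p.1)) (by fun_prop)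
  norm_le t _ := h.norm_le t _
  integrable := h.integrable

/-- The linearized equation is itself a field of the class `IsC1Field`, so it has global solutions.
The operator-valued solution is assembled from the vector-valued ones which start at an orthonormal
basis. -/
lemma exists_variation (h : IsC1Field V DV k) {γ : ℝ → F} (hγ : Continuous γ) :
    ∃ J : ℝ → F →L[ℝ] F, J 0 = ContinuousLinearMap.id ℝ F ∧
      ∀ t, HasDerivAt J ((DV t (γ t)).comp (J t)) t := by
  let b := stdOrthonormalBasis ℝ F
  have hw := h.variational hγ
  refine ⟨fun t => ∑ i, (innerSL ℝ (b i)).smulRight (hw.flow 0 t (b i)), ?_, fun t => ?_⟩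
  · ext x
    simp only [hw.flow_self, sum_apply,
      ContinuousLinearMap.smulRight_apply, innerSL_apply_apply, ContinuousLinearMap.id_apply]
    exact b.sum_repr' x
  · have : HasDerivAt (fun t => ∑ i, (innerSL ℝ (b i)).smulRight (hw.flow 0 t (b i)))
        (∑ i, (innerSL ℝ (b i)).smulRight (DV t (γ t) (hw.flow 0 t (b i)))) t := by
      refine HasDerivAt.fun_sum fun i _ => ?_
      exact (ContinuousLinearMap.smulRightL ℝ F F (innerSL ℝ (b i))).hasFDerivAt.comp_hasDerivAt t
        (hw.isIntegralCurve_flow 0 (b i) t)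
    convert this using 1
    ext x
    simp

/-- Along a curve, the field is uniformly close to its linearization. -/
lemma exists_norm_sub_sub_le (h : IsC1Field V DV k) {γ : ℝ → F} (hγ : Continuous γ) (a b : ℝ)
    {ε : ℝ} (hε : 0 < ε) :
    ∃ δ > 0, ∀ t ∈ Icc a b, ∀ y z, ‖y - γ t‖ < δ → ‖z - γ t‖ < δ →
      ‖V t y - V t z - DV t (γ t) (y - z)‖ ≤ ε * ‖y - z‖ := by
  have hc : Continuous fun p : F × ℝ => ‖DV p.2 (γ p.2 + p.1) - DV p.2 (γ p.2)‖ :=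
    ((h.continuous_deriv.comp (f := fun p : F × ℝ => (p.2, γ p.2 + p.1)) (by fun_prop)).sub
      (h.continuous_deriv.comp (f := fun p : F × ℝ => (p.2, γ p.2)) (by fun_prop))).norm
  -- Compactness of the time interval (the tube lemma) makes the neighbourhood independent of `t`;
  -- the mean value inequality then does the rest.
  have hev : ∀ᶠ w in 𝓝 (0 : F), ∀ t ∈ Icc a b, ‖DV t (γ t + w) - DV t (γ t)‖ < ε := by
    refine isCompact_Icc.eventually_forall_of_forall_eventually fun t _ => ?_
    exact (hc.tendsto (0, t)).eventually (gt_mem_nhds (by simpa using hε))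
  obtain ⟨δ, hδ, hball⟩ := Metric.eventually_nhds_iff_ball.1 hev
  refine ⟨δ, hδ, fun t ht y z hy hz => ?_⟩
  refine (convex_ball (γ t) δ).norm_image_sub_le_of_norm_hasFDerivWithin_le'
    (fun x _ => (h.hasFDerivAt t x).hasFDerivWithinAt) (fun x hx => ?_)
    (by simpa [dist_eq_norm] using hz) (by simpa [dist_eq_norm] using hy)
  have := hball (x - γ t) (by simpa [dist_eq_norm] using hx) t ht
  rw [add_sub_cancel] at this
  exact this.le

/-- The difference of two trajectories near the base trajectory solves the variational equation up
to an error `ε * M * ‖y - z‖`, and Grönwall's inequality compares it with `J t (y - z)`. Taking both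
initial points variable gives a strict derivative, from which continuity of the derivative in `x`
follows without studying how `J` depends on `x`. -/
lemma hasStrictFDerivAt_flow (h : IsC1Field V DV k) {T : ℝ} (hT : 0 ≤ T) (x : F)
    {J : ℝ → F →L[ℝ] F} (hJ0 : J 0 = ContinuousLinearMap.id ℝ F)
    (hJ : ∀ t, HasDerivAt J ((DV t (h.flow 0 t x)).comp (J t)) t) :
    HasStrictFDerivAt (h.flow 0 T) (J T) x := by
  set γ := fun t => h.flow 0 t x with hγdef
  have hγ : Continuous γ := (h.isIntegralCurve_flow 0 x).continuous
  set M := Real.exp (∫ t in (0 : ℝ)..T, k t)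
  have hM : ∀ t ∈ Icc 0 T, ∀ y z, ‖h.flow 0 t y - h.flow 0 t z‖ ≤ M * ‖y - z‖ := by
    intro t ht y z
    have := (h.norm_sub_le_exp_mul (h.isIntegralCurve_flow 0 y) (h.isIntegralCurve_flow 0 z)
      ht.1).1
    simp only [h.flow_self] at this
    refine this.trans (mul_le_mul_of_nonneg_right (Real.exp_le_exp.2 ?_) (norm_nonneg _))
    exact intervalIntegral.integral_mono_interval le_rfl ht.1 ht.2
      (ae_of_all _ fun τ => h.nonneg τ) (h.integrable 0 T)
  have hMpos : 0 < M := Real.exp_pos _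
  have hA : Continuous fun t => DV t (γ t) :=
    h.continuous_deriv.comp (f := fun t : ℝ => (t, γ t)) (by fun_prop)
  obtain ⟨K, hK⟩ := (isCompact_Icc (a := 0) (b := T)).exists_bound_of_continuousOn hA.continuousOn
  rw [hasStrictFDerivAt_iff_isLittleO, Asymptotics.isLittleO_iff]
  intro c hc
  -- With zero initial error the Grönwall bound is linear in the perturbation; `G` is its slope, and
  -- `ε` is chosen so that `ε * M * G ≤ c`.
  set G := gronwallBound 0 K.toNNReal 1 T with hG
  have hG0 : 0 ≤ G := by
    have := gronwallBound_mono le_rfl zero_le_one K.toNNReal.2 hT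
    rwa [gronwallBound_x0] at this
  set ε := c / (M * (G + 1)) with hεdef
  have hε : 0 < ε := by positivity
  obtain ⟨δ, hδ, hlin⟩ := h.exists_norm_sub_sub_le hγ 0 T hε
  have hev : ∀ᶠ p : F × F in 𝓝 (x, x), ‖p.1 - x‖ < δ / M ∧ ‖p.2 - x‖ < δ / M := by
    have hpos : 0 < δ / M := by positivity
    refine Filter.Eventually.and ?_ ?_
    · exact ((by fun_prop : Continuous fun p : F × F => ‖p.1 - x‖).tendsto (x, x)).eventually
        (gt_mem_nhds (by simpa using hpos))
    · exact ((by fun_prop : Continuous fun p : F × F => ‖p.2 - x‖).tendsto (x, x)).eventually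
        (gt_mem_nhds (by simpa using hpos))
  filter_upwards [hev] with ⟨y, z⟩ ⟨hy, hz⟩
  have hnear : ∀ w : F, ‖w - x‖ < δ / M → ∀ t ∈ Icc 0 T, ‖h.flow 0 t w - γ t‖ < δ := by
    intro w hw t ht
    refine (hM t ht w x).trans_lt ?_
    rwa [lt_div_iff₀ hMpos, mul_comm] at hw
  have hd : ∀ t, HasDerivAt (fun t => h.flow 0 t y - h.flow 0 t z)
      (V t (h.flow 0 t y) - V t (h.flow 0 t z)) t := fun t =>
    (h.isIntegralCurve_flow 0 y t).sub (h.isIntegralCurve_flow 0 z t)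
  have hJd : ∀ t, HasDerivAt (fun t => J t (y - z)) (DV t (γ t) (J t (y - z))) t := fun t => by
    simpa using (hJ t).clm_apply (hasDerivAt_const t (y - z))
  have hgr := dist_le_of_approx_trajectories_ODE_of_mem (v := fun t w => DV t (γ t) w)
    (s := fun _ => univ) (K := K.toNNReal) (a := 0) (b := T) (εf := ε * (M * ‖y - z‖)) (εg := 0)
    (δ := 0) (fun t ht => ?_)
    (fun t _ => (hd t).continuousAt.continuousWithinAt) (fun t _ => (hd t).hasDerivWithinAt)
    (fun t ht => ?_) (fun _ _ => mem_univ _)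
    (fun t _ => (hJd t).continuousAt.continuousWithinAt) (fun t _ => (hJd t).hasDerivWithinAt)
    (fun t _ => by simp) (fun _ _ => mem_univ _) (by simp [h.flow_self, hJ0]) T ⟨hT, le_rfl⟩
  · rw [dist_eq_norm, sub_zero, add_zero] at hgr
    refine hgr.trans ?_
    have hlinear : gronwallBound 0 K.toNNReal (ε * (M * ‖y - z‖)) T = ε * (M * ‖y - z‖) * G := by
      rw [hG]
      unfold gronwallBound
      split_ifs <;> ring
    rw [hlinear]
    have : ε * M * G ≤ c := by
      rw [hεdef, div_mul_eq_mul_div, div_mul_eq_mul_div, div_le_iff₀ (by positivity)]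
      nlinarith [mul_pos hc hMpos]
    calc ε * (M * ‖y - z‖) * G = ε * M * G * ‖y - z‖ := by ring
      _ ≤ c * ‖y - z‖ := by gcongr
  · refine ((DV t (γ t)).lipschitz.weaken ?_).lipschitzOnWith
    rw [← NNReal.coe_le_coe, coe_nnnorm]
    exact (hK t (Ico_subset_Icc_self ht)).trans (Real.le_coe_toNNReal K)
  · have ht' := Ico_subset_Icc_self ht
    rw [dist_eq_norm]
    refine (hlin t ht' _ _ (hnear y hy t ht') (hnear z hz t ht')).trans ?_
    gcongr
    exact hM t ht' y z

end IsC1Field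

/-- A map with strict derivatives everywhere is `C¹`. -/
lemma contDiff_one_of_hasStrictFDerivAt {f : F → F} {f' : F → F →L[ℝ] F}
    (h : ∀ x, HasStrictFDerivAt f (f' x) x) : ContDiff ℝ 1 f := by
  refine contDiff_one_iff_hasFDerivAt.2 ⟨f', ?_, fun x => (h x).hasFDerivAt⟩
  rw [continuous_iff_continuousAt]
  intro x
  rw [Metric.continuousAt_iff']
  intro ε hε
  -- Strict differentiability makes `f - f' x` Lipschitz with constant `ε / 2` near `x`, so its
  -- derivative `f' y - f' x` at a nearby `y` has norm at most `ε / 2`.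
  obtain ⟨s, hs, hlip⟩ := (h x).approximates_deriv_on_nhds (c := (ε / 2).toNNReal)
    (Or.inr (by simpa using hε))
  filter_upwards [eventually_mem_nhds_iff.2 hs] with y hy
  have hl : LipschitzOnWith (ε / 2).toNNReal (fun z => f z - f' x z) s := by
    refine LipschitzOnWith.of_dist_le_mul fun z hz w hw => ?_
    rw [dist_eq_norm, dist_eq_norm]
    have he : f z - f' x z - (f w - f' x w) = f z - f w - f' x (z - w) := by
      rw [map_sub]
      abel
    rw [he]
    exact hlip z hz w hw
  have := ((h y).hasFDerivAt.sub (f' x).hasFDerivAt).le_of_lipschitzOn hy hl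
  rw [Real.coe_toNNReal _ (by positivity)] at this
  rw [dist_eq_norm]
  linarith

lemma differentiable_det : Differentiable ℝ (fun A : F →L[ℝ] F => A.det) := by
  let b := stdOrthonormalBasis ℝ F
  have : (fun A : F →L[ℝ] F => A.det) = fun A : F →L[ℝ] F =>
      ∑ σ : Equiv.Perm (Fin (Module.finrank ℝ F)),
        ((Equiv.Perm.sign σ : ℤ) : ℝ) * ∏ i, inner ℝ (b (σ i)) (A (b i)) := by
    ext A
    rw [ContinuousLinearMap.det, ← LinearMap.det_toMatrix b.toBasis, Matrix.det_apply']
    simp [LinearMap.toMatrix_apply, OrthonormalBasis.repr_apply_apply]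
  rw [this]
  refine Differentiable.fun_sum fun σ _ => Differentiable.const_mul (fun A => ?_) _
  exact (HasFDerivAt.finsetProd (u := Finset.univ) fun i _ =>
    ((innerSL ℝ (b (σ i))).comp (ContinuousLinearMap.apply ℝ F (b i))).hasFDerivAt).differentiableAt

/-- Liouville's formula. The derivative of `det` at `J t` in the direction `A ∘ J t` can be computed
along the line `J t + r • A ∘ J t = (1 + r • A) ∘ J t`, where the determinant factors and `det (1 +
r • A) = 1 + r * trace A + O(r ^ 2)`. Invertibility of `J t` is not needed. -/
lemma hasDerivAt_det_of_hasDerivAt_mul {J : ℝ → F →L[ℝ] F} {A : F →L[ℝ] F} {t : ℝ}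
    (hJ : HasDerivAt J (A.comp (J t)) t) :
    HasDerivAt (fun s => (J s).det) (LinearMap.trace ℝ F A * (J t).det) t := by
  have h1 := (differentiable_det (J t)).hasFDerivAt.comp_hasDerivAt t hJ
  have hlin : HasDerivAt (fun r : ℝ => J t + r • A.comp (J t)) (A.comp (J t)) 0 := by
    simpa using ((hasDerivAt_id (0 : ℝ)).smul_const (A.comp (J t))).const_add (J t)
  have h2 : HasDerivAt (fun r : ℝ => (J t + r • A.comp (J t)).det)
      (fderiv ℝ (fun A : F →L[ℝ] F => A.det) (J t) (A.comp (J t))) 0 := by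
    have := (differentiable_det (J t + (0 : ℝ) • A.comp (J t))).hasFDerivAt.comp_hasDerivAt 0 hlin
    simpa [Function.comp_def] using! this
  let b := stdOrthonormalBasis ℝ F
  let m := LinearMap.toMatrix b.toBasis b.toBasis (A : F →ₗ[ℝ] F)
  have hfac : ∀ r : ℝ, (J t + r • A.comp (J t)).det = (1 + r • m).det * (J t).det := by
    intro r
    have : ((J t + r • A.comp (J t) : F →L[ℝ] F) : F →ₗ[ℝ] F) =
        (LinearMap.id + r • (A : F →ₗ[ℝ] F)).comp (J t : F →ₗ[ℝ] F) := by
      ext x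
      simp
    rw [ContinuousLinearMap.det, this, LinearMap.det_comp,
      ← LinearMap.det_toMatrix b.toBasis (LinearMap.id + _)]
    rw [map_add, map_smul, LinearMap.toMatrix_id]
  have h3 : HasDerivAt (fun r : ℝ => (J t + r • A.comp (J t)).det)
      (LinearMap.trace ℝ F A * (J t).det) 0 := by
    have hpoly : (fun r : ℝ => (J t + r • A.comp (J t)).det) = fun r => (1 + m.trace * r +
        Polynomial.eval r (1 + (Polynomial.X : Polynomial ℝ) • m.map Polynomial.C).det.divX.divX *
          r ^ 2) * (J t).det := by
      ext r
      rw [hfac, Matrix.det_one_add_smul]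
    rw [hpoly, LinearMap.trace_eq_matrix_trace ℝ b.toBasis]
    refine HasDerivAt.mul_const ?_ _
    set q := (1 + (Polynomial.X : Polynomial ℝ) • m.map Polynomial.C).det.divX.divX
    have hq := (q.hasDerivAt 0).mul (hasDerivAt_pow 2 (0 : ℝ))
    have hl := ((hasDerivAt_id (0 : ℝ)).const_mul m.trace).const_add 1
    convert! hl.add hq using 1
    simp [m]
  rw [← h2.unique h3]
  exact h1

end ODE

/-! ### The standard Gaussian: density and Stein's identity -/

section Gaussian

variable {n : ℕ}

/-- The density of the standard Gaussian measure. -/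
noncomputable def gaussDensity (x : E n) : ℝ :=
  (∫ v : E n, Real.exp (-‖v‖ ^ 2 / 2))⁻¹ * Real.exp (-‖x‖ ^ 2 / 2)

lemma integrable_exp_neg_norm_sq : Integrable fun v : E n => Real.exp (-‖v‖ ^ 2 / 2) := by
  have := (GaussianFourier.integrable_cexp_neg_mul_sq_norm_add (V := E n) (b := (1 / 2 : ℂ))
    (by norm_num) 0 0).norm
  refine this.congr (ae_of_all _ fun v => ?_)
  simp only [Complex.norm_exp]
  congr 1
  simp [← Complex.ofReal_pow]
  ring

lemma gaussNorm_pos : 0 < ∫ v : E n, Real.exp (-‖v‖ ^ 2 / 2) :=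
  integral_exp_pos integrable_exp_neg_norm_sq

lemma gaussDensity_pos (x : E n) : 0 < gaussDensity x :=
  mul_pos (inv_pos.2 gaussNorm_pos) (Real.exp_pos _)

lemma contDiff_gaussDensity : ContDiff ℝ 1 (gaussDensity : E n → ℝ) := by
  unfold gaussDensity
  exact contDiff_const.mul ((contDiff_norm_sq ℝ).neg.div_const 2).exp

lemma continuous_gaussDensity : Continuous (gaussDensity : E n → ℝ) :=
  contDiff_gaussDensity.continuous

lemma integrable_gaussDensity : Integrable (gaussDensity : E n → ℝ) :=
  integrable_exp_neg_norm_sq.const_mul _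

lemma fderiv_gaussDensity (x v : E n) :
    fderiv ℝ gaussDensity x v = -inner ℝ x v * gaussDensity x := by
  have h1 : HasFDerivAt (fun x : E n => -‖x‖ ^ 2 / 2) (-innerSL ℝ x) x := by
    have := ((hasStrictFDerivAt_norm_sq x).hasFDerivAt.neg).mul_const (2⁻¹ : ℝ)
    simp only [div_eq_mul_inv]
    convert! this using 1
    ext y
    simp
  have h2 : HasFDerivAt (gaussDensity : E n → ℝ) _ x := (h1.exp).const_mul _
  rw [h2.fderiv]
  simp [gaussDensity]
  ring

/-- Both measures have the same characteristic function. The normalizing constant need not be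
evaluated: the Gaussian Fourier integral at frequency `0` produces the same constant, and the two
cancel. -/
lemma stdGaussian_eq_withDensity :
    stdGaussian (E n) = volume.withDensity fun x => ENNReal.ofReal (gaussDensity x) := by
  have hmeas : Measurable fun x : E n => ENNReal.ofReal (gaussDensity x) :=
    continuous_gaussDensity.measurable.ennreal_ofReal
  have : IsFiniteMeasure (volume.withDensity fun x : E n => ENNReal.ofReal (gaussDensity x)) :=
    isFiniteMeasure_withDensity_ofReal integrable_gaussDensity.2
  refine Measure.ext_of_charFun ?_
  ext t
  rw [charFun_stdGaussian, charFun_apply, integral_withDensity_eq_integral_toReal_smul hmeas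
    (ae_of_all _ fun _ => ENNReal.ofReal_lt_top)]
  have hform : ∀ t : E n, ∫ x : E n, ((Real.exp (-‖x‖ ^ 2 / 2) : ℝ) : ℂ) *
      Complex.exp (inner ℝ x t * Complex.I) =
      (Real.pi / (1 / 2 : ℂ)) ^ ((Module.finrank ℝ (E n) : ℂ) / 2) *
        Complex.exp (-(‖t‖ : ℂ) ^ 2 / 2) := by
    intro t
    have := GaussianFourier.integral_cexp_neg_mul_sq_norm_add (V := E n) (b := (1 / 2 : ℂ))
      (by norm_num) Complex.I t
    rw [show Complex.I ^ 2 * (‖t‖ : ℂ) ^ 2 / (4 * (1 / 2)) = -(‖t‖ : ℂ) ^ 2 / 2 by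
      rw [Complex.I_sq]; ring] at this
    rw [← this]
    refine integral_congr_ae (ae_of_all _ fun x => ?_)
    simp only [Complex.ofReal_exp, ← Complex.exp_add, real_inner_comm x t]
    congr 1
    push_cast
    ring
  have h0 := hform 0
  simp only [inner_zero_right, Complex.ofReal_zero, zero_mul, Complex.exp_zero, mul_one,
    norm_zero, ne_eq, OfNat.ofNat_ne_zero, not_false_eq_true, zero_pow, neg_zero, zero_div] at h0
  rw [integral_complex_ofReal] at h0
  have hpos : ((∫ v : E n, Real.exp (-‖v‖ ^ 2 / 2) : ℝ) : ℂ) ≠ 0 := by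
    exact_mod_cast gaussNorm_pos.ne'
  have hc : ∀ x : E n, (ENNReal.ofReal (gaussDensity x)).toReal •
      Complex.exp (inner ℝ x t * Complex.I) = ((∫ v : E n, Real.exp (-‖v‖ ^ 2 / 2) : ℝ) : ℂ)⁻¹ *
        (((Real.exp (-‖x‖ ^ 2 / 2) : ℝ) : ℂ) * Complex.exp (inner ℝ x t * Complex.I)) := by
    intro x
    rw [ENNReal.toReal_ofReal (gaussDensity_pos x).le, gaussDensity, Complex.real_smul]
    push_cast
    ring
  simp only [hc]
  rw [integral_const_mul, hform, ← h0, inv_mul_cancel_left₀ hpos]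

lemma integrable_stdGaussian_iff {G : Type*} [NormedAddCommGroup G] [NormedSpace ℝ G]
    {f : E n → G} :
    Integrable f (stdGaussian (E n)) ↔ Integrable fun x => gaussDensity x • f x := by
  rw [stdGaussian_eq_withDensity, integrable_withDensity_iff_integrable_smul'
    continuous_gaussDensity.measurable.ennreal_ofReal (ae_of_all _ fun _ => ENNReal.ofReal_lt_top)]
  simp only [ENNReal.toReal_ofReal (gaussDensity_pos _).le]

lemma integral_stdGaussian {G : Type*} [NormedAddCommGroup G] [NormedSpace ℝ G] (f : E n → G) :
    ∫ x, f x ∂stdGaussian (E n) = ∫ x, gaussDensity x • f x := by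
  rw [stdGaussian_eq_withDensity, integral_withDensity_eq_integral_toReal_smul
    continuous_gaussDensity.measurable.ennreal_ofReal (ae_of_all _ fun _ => ENNReal.ofReal_lt_top)]
  simp only [ENNReal.toReal_ofReal (gaussDensity_pos _).le]

lemma lintegral_stdGaussian (f : E n → ℝ≥0∞) (hf : Measurable f) :
    ∫⁻ x, f x ∂stdGaussian (E n) = ∫⁻ x, ENNReal.ofReal (gaussDensity x) * f x := by
  rw [stdGaussian_eq_withDensity, lintegral_withDensity_eq_lintegral_mul _
    continuous_gaussDensity.measurable.ennreal_ofReal hf]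
  rfl

lemma stdGaussian_absolutelyContinuous : stdGaussian (E n) ≪ volume := by
  rw [stdGaussian_eq_withDensity]
  exact withDensity_absolutelyContinuous _ _

lemma integrable_norm_stdGaussian : Integrable (fun z => ‖z‖) (stdGaussian (E n)) :=
  (IsGaussian.integrable_id (μ := stdGaussian (E n))).norm

lemma integrable_norm_sq_stdGaussian : Integrable (fun z => ‖z‖ ^ 2) (stdGaussian (E n)) :=
  (IsGaussian.memLp_two_id (μ := stdGaussian (E n))).integrable_norm_pow (by norm_num)

/-- Stein's identity. -/
lemma integral_inner_mul_stdGaussian {u : E n → ℝ} (hu : ContDiff ℝ 1 u) {C : ℝ}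
    (hC : ∀ x, |u x| ≤ C) (v : E n) {C' : ℝ} (hC' : ∀ x, |fderiv ℝ u x v| ≤ C') :
    ∫ z, inner ℝ z v * u z ∂stdGaussian (E n) = ∫ z, fderiv ℝ u z v ∂stdGaussian (E n) := by
  have hu' : Continuous fun z => fderiv ℝ u z v :=
    (hu.continuous_fderiv one_ne_zero).clm_apply continuous_const
  have i1 : Integrable (fun z => fderiv ℝ u z v) (stdGaussian (E n)) :=
    Integrable.of_bound hu'.aestronglyMeasurable C' (ae_of_all _ hC')
  have i2 : Integrable u (stdGaussian (E n)) :=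
    Integrable.of_bound hu.continuous.aestronglyMeasurable C (ae_of_all _ hC)
  have i3 : Integrable (fun z => inner ℝ z v * u z) (stdGaussian (E n)) := by
    refine ((integrable_norm_stdGaussian.mul_const ‖v‖).mul_const C).mono'
      ((continuous_id.inner continuous_const).mul hu.continuous).aestronglyMeasurable
      (ae_of_all _ fun z => ?_)
    rw [norm_mul]
    exact mul_le_mul (norm_inner_le_norm _ _) (hC z) (norm_nonneg _) (by positivity)
  rw [integrable_stdGaussian_iff] at i1 i2 i3
  -- Integration by parts against the Gaussian density, whose derivative along `v` is `-⟪z, v⟫`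
  -- times itself. Integrability of the three products replaces a discussion of boundary terms.
  have key := integral_mul_fderiv_eq_neg_fderiv_mul_of_integrable (μ := (volume : Measure (E n)))
    (f := u) (g := gaussDensity) (v := v) (i1.congr (ae_of_all _ fun z => ?_))
    (i3.neg.congr (ae_of_all _ fun z => ?_)) (i2.congr (ae_of_all _ fun z => ?_))
    (fun x _ => hu.differentiable one_ne_zero x)
    (fun x _ => contDiff_gaussDensity.differentiable one_ne_zero x)
  · rw [integral_stdGaussian, integral_stdGaussian]
    simp only [fderiv_gaussDensity] at key
    rw [← neg_inj, ← integral_neg, ← integral_neg]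
    rw [← integral_neg] at key
    have e1 : ∀ z : E n, -(gaussDensity z • (inner ℝ z v * u z)) =
        u z * (-inner ℝ z v * gaussDensity z) := fun z => by rw [smul_eq_mul]; ring
    have e2 : ∀ z : E n, -(gaussDensity z • fderiv ℝ u z v) =
        -(fderiv ℝ u z v * gaussDensity z) := fun z => by rw [smul_eq_mul]; ring
    simp only [e1, e2]
    exact key
  · simp only [smul_eq_mul]; ring
  · simp only [fderiv_gaussDensity, Pi.neg_apply, smul_eq_mul]; ring
  · simp only [smul_eq_mul]; ring

/-- The trace of a bilinear form. -/
noncomputable def bilinTrace (B : E n →L[ℝ] E n →L[ℝ] ℝ) : ℝ :=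
  ∑ i, B (EuclideanSpace.basisFun (Fin n) ℝ i) (EuclideanSpace.basisFun (Fin n) ℝ i)

/-- Stein's identity for the gradient of a function at an affine image of the variable. -/
lemma integral_fderiv_apply_stdGaussian {f : E n → ℝ} (hf : ContDiff ℝ 2 f) {C₁ C₂ : ℝ}
    (h₁ : ∀ x, ‖fderiv ℝ f x‖ ≤ C₁) (h₂ : ∀ x, ‖fderiv ℝ (fderiv ℝ f) x‖ ≤ C₂) (c : E n)
    (b : ℝ) :
    ∫ z, fderiv ℝ f (c - b • z) z ∂stdGaussian (E n) =
      -(b * ∫ z, bilinTrace (fderiv ℝ (fderiv ℝ f) (c - b • z)) ∂stdGaussian (E n)) := by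
  have hC₁ : 0 ≤ C₁ := (norm_nonneg _).trans (h₁ 0)
  have hC₂ : 0 ≤ C₂ := (norm_nonneg (fderiv ℝ (fderiv ℝ f) 0)).trans (h₂ 0)
  have hf1 : ContDiff ℝ 1 (fderiv ℝ f) := hf.fderiv_right (by norm_num)
  have hf2 : Continuous (fderiv ℝ (fderiv ℝ f)) := hf1.continuous_fderiv one_ne_zero
  let e := EuclideanSpace.basisFun (Fin n) ℝ
  have he : ∀ i, ‖e i‖ = 1 := e.norm_eq_one
  -- Expanding `z` in coordinates allows Stein's identity to be applied to each basis direction; the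
  -- chain rule contributes the factor `-b`.
  have hsum : ∀ z : E n, fderiv ℝ f (c - b • z) z =
      ∑ i, inner ℝ z (e i) * fderiv ℝ f (c - b • z) (e i) := by
    intro z
    have := congrArg (fderiv ℝ f (c - b • z)) (e.sum_repr' z).symm
    rw [map_sum] at this
    rw [this]
    exact Finset.sum_congr rfl fun i _ => by rw [map_smul, smul_eq_mul, real_inner_comm]
  have hu : ∀ i, ContDiff ℝ 1 fun z : E n => fderiv ℝ f (c - b • z) (e i) := fun i =>
    (hf1.comp (by fun_prop : ContDiff ℝ 1 fun z : E n => c - b • z)).clm_apply contDiff_const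
  have hub : ∀ i z, |fderiv ℝ f (c - b • z) (e i)| ≤ C₁ := fun i z => by
    have := (fderiv ℝ f (c - b • z)).le_opNorm (e i)
    rw [he, mul_one] at this
    exact this.trans (h₁ _)
  have hder : ∀ i z, fderiv ℝ (fun z : E n => fderiv ℝ f (c - b • z) (e i)) z (e i) =
      -(b * fderiv ℝ (fderiv ℝ f) (c - b • z) (e i) (e i)) := by
    intro i z
    have haff : HasFDerivAt (fun z : E n => c - b • z) (-(b • ContinuousLinearMap.id ℝ (E n))) z :=
      ((hasFDerivAt_id z).const_smul b).const_sub c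
    have h := (((hf1.differentiable one_ne_zero) (c - b • z)).hasFDerivAt.comp z haff).clm_apply
      (hasFDerivAt_const (e i) z)
    have h' := congrArg (fun A => A (e i)) h.fderiv
    simp only [Function.comp_apply] at h'
    rw [h']
    simp
  have hb2 : ∀ i z, |fderiv ℝ (fderiv ℝ f) (c - b • z) (e i) (e i)| ≤ C₂ := fun i z => by
    have := (fderiv ℝ (fderiv ℝ f) (c - b • z)).le_opNorm₂ (e i) (e i)
    rw [he, mul_one, mul_one] at this
    exact this.trans (h₂ _)
  have hud : ∀ i z, |fderiv ℝ (fun z : E n => fderiv ℝ f (c - b • z) (e i)) z (e i)| ≤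
      |b| * C₂ := fun i z => by
    rw [hder, abs_neg, abs_mul]
    exact mul_le_mul_of_nonneg_left (hb2 i z) (abs_nonneg _)
  simp only [hsum, bilinTrace]
  rw [integral_finsetSum, integral_finsetSum, Finset.mul_sum, ← Finset.sum_neg_distrib]
  · refine Finset.sum_congr rfl fun i _ => ?_
    rw [integral_inner_mul_stdGaussian (hu i) (hub i) (e i) (hud i)]
    simp only [hder]
    rw [integral_neg, integral_const_mul]
  · intro i _
    refine Integrable.of_bound ?_ C₂ (ae_of_all _ (hb2 i))
    exact (((hf2.comp (by fun_prop : Continuous fun z : E n => c - b • z)).clm_apply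
      continuous_const).clm_apply continuous_const).aestronglyMeasurable
  · intro i _
    refine ((integrable_norm_stdGaussian.mul_const ‖e i‖).mul_const C₁).mono'
      ((continuous_id.inner continuous_const).mul (hu i).continuous).aestronglyMeasurable
      (ae_of_all _ fun z => ?_)
    rw [norm_mul]
    exact mul_le_mul (norm_inner_le_norm _ _) (hub i z) (norm_nonneg _) (by positivity)

end Gaussian

/-! ### The law of the solution of the stochastic differential equation -/

section Law

/-- The `k`-th point of the subdivision of `[0, t]` into `m + 1` intervals of equal length. -/
noncomputable def gridPoint (t : ℝ≥0) (m k : ℕ) : ℝ≥0 := k * (t / (m + 1))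

lemma gridPoint_zero (t : ℝ≥0) (m : ℕ) : gridPoint t m 0 = 0 := by simp [gridPoint]

lemma gridPoint_last (t : ℝ≥0) (m : ℕ) : gridPoint t m (m + 1) = t := by
  unfold gridPoint
  push_cast
  exact mul_div_cancel₀ t (by positivity)

lemma gridPoint_succ (t : ℝ≥0) (m k : ℕ) :
    gridPoint t m (k + 1) = gridPoint t m k + t / (m + 1) := by
  unfold gridPoint
  push_cast
  ring

lemma gridPoint_mono (t : ℝ≥0) (m : ℕ) : Monotone (gridPoint t m) :=
  monotone_nat_of_le_succ fun k => by rw [gridPoint_succ]; exact le_self_add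

/-- The Riemann sum which approximates `∫₀ᵗ exp (s / 2) dw_s`. -/
noncomputable def noiseSum {G : Type*} [AddCommGroup G] [Module ℝ G] (w : ℝ≥0 → G) (t : ℝ≥0)
    (m : ℕ) : G :=
  ∑ k ∈ Finset.range (m + 1),
    Real.exp (gridPoint t m k / 2) • (w (gridPoint t m (k + 1)) - w (gridPoint t m k))

/-- For a solution of the variance-preserving equation, the Riemann sums of the noise converge
pathwise. -/
lemma tendsto_noiseSum {G : Type*} [NormedAddCommGroup G] [NormedSpace ℝ G] [CompleteSpace G]
    {x w : ℝ≥0 → G} (hx : Continuous x)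
    (heq : ∀ t : ℝ≥0, x t = x 0 + (∫ s in (0 : ℝ)..t, (-(1 / 2 : ℝ)) • x s.toNNReal) + w t)
    (t : ℝ≥0) :
    Tendsto (noiseSum w t) atTop (𝓝 (Real.exp (t / 2) • x t - x 0)) := by
  let y : ℝ → G := fun s => x s.toNNReal
  have hy : Continuous y := hx.comp continuous_real_toNNReal
  have hexp : ∀ a b : ℝ, ∫ s in a..b, (1 / 2 : ℝ) * Real.exp (s / 2) =
      Real.exp (b / 2) - Real.exp (a / 2) := by
    intro a b
    have hc : Continuous fun s : ℝ => (1 / 2 : ℝ) * Real.exp (s / 2) := by fun_prop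
    refine intervalIntegral.integral_eq_sub_of_hasDerivAt
      (f := fun s : ℝ => Real.exp (s / 2)) (fun s _ => ?_) (hc.intervalIntegrable _ _)
    rw [mul_comm]
    exact ((hasDerivAt_id' s).div_const 2).exp
  -- On one step, the increment of `exp (s / 2) • x s` minus the noise term is an ordinary integral.
  -- Its integrand is a difference of nearby values of `(r, s) ↦ exp (r / 2) • y s`, hence small by
  -- uniform continuity. No stochastic integral is needed.
  have hstep : ∀ a b : ℝ≥0, a ≤ b →
      Real.exp (b / 2) • x b - Real.exp (a / 2) • x a - Real.exp (a / 2) • (w b - w a) =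
      ∫ s in (a : ℝ)..b, (1 / 2 : ℝ) • (Real.exp (s / 2) • y b - Real.exp (a / 2) • y s) := by
    intro a b _
    have hw : w b - w a = x b - x a + (1 / 2 : ℝ) • ∫ s in (a : ℝ)..b, y s := by
      have h1 := heq b
      have h2 := heq a
      rw [intervalIntegral.integral_smul] at h1 h2
      have h3 := intervalIntegral.integral_add_adjacent_intervals (μ := volume)
        (hy.intervalIntegrable 0 a) (hy.intervalIntegrable a b)
      have h1' : w b = x b - x 0 + (1 / 2 : ℝ) • ∫ s in (0 : ℝ)..b, y s := by
        rw [neg_smul] at h1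
        nth_rewrite 1 [h1]
        abel
      have h2' : w a = x a - x 0 + (1 / 2 : ℝ) • ∫ s in (0 : ℝ)..a, y s := by
        rw [neg_smul] at h2
        nth_rewrite 1 [h2]
        abel
      rw [h1', h2', ← h3, smul_add]
      abel
    have hyb : y b = x b := by simp [y]
    have hsplit : ∫ s in (a : ℝ)..b, (1 / 2 : ℝ) • (Real.exp (s / 2) • y b -
        Real.exp (a / 2) • y s) = (∫ s in (a : ℝ)..b, (1 / 2 : ℝ) * Real.exp (s / 2)) • y b -
          (1 / 2 * Real.exp (a / 2) : ℝ) • ∫ s in (a : ℝ)..b, y s := by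
      rw [← intervalIntegral.integral_smul_const, ← intervalIntegral.integral_smul,
        ← intervalIntegral.integral_sub]
      · simp only [smul_sub, smul_smul]
      · exact Continuous.intervalIntegrable (by fun_prop) _ _
      · exact Continuous.intervalIntegrable (by fun_prop) _ _
    rw [hsplit, hexp, hw, hyb]
    module
  rw [Metric.tendsto_atTop]
  intro ε hε
  have hK : IsCompact (Icc (0 : ℝ) t ×ˢ Icc (0 : ℝ) t) := isCompact_Icc.prod isCompact_Icc
  have hg : Continuous fun p : ℝ × ℝ => Real.exp (p.1 / 2) • y p.2 :=
    (by fun_prop : Continuous fun p : ℝ × ℝ => Real.exp (p.1 / 2)).smul (hy.comp continuous_snd)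
  -- The tolerance `ε / (t + 1)` sums over the subdivision to `ε * t / (t + 1) < ε`, also when `t =
  -- 0`.
  obtain ⟨δ, hδ, hunif⟩ := Metric.uniformContinuousOn_iff.1
    (hK.uniformContinuousOn_of_continuous hg.continuousOn) (ε / (t + 1)) (by positivity)
  obtain ⟨N, hN⟩ := exists_nat_gt (t / δ)
  refine ⟨N, fun m hm => ?_⟩
  have hmesh : (t : ℝ) / (m + 1) < δ := by
    have : (N : ℝ) ≤ m := by exact_mod_cast hm
    rw [div_lt_iff₀ (by positivity)]
    rw [div_lt_iff₀ hδ] at hN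
    nlinarith
  have htel : Real.exp (t / 2) • x t - x 0 = ∑ k ∈ Finset.range (m + 1),
      (Real.exp (gridPoint t m (k + 1) / 2) • x (gridPoint t m (k + 1)) -
        Real.exp (gridPoint t m k / 2) • x (gridPoint t m k)) := by
    rw [Finset.sum_range_sub (fun k => Real.exp (gridPoint t m k / 2) • x (gridPoint t m k)),
      gridPoint_last, gridPoint_zero]
    simp
  rw [dist_comm, dist_eq_norm, htel, noiseSum, ← Finset.sum_sub_distrib]
  have hbound : ∀ k ∈ Finset.range (m + 1),
      ‖(Real.exp (gridPoint t m (k + 1) / 2) • x (gridPoint t m (k + 1)) -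
        Real.exp (gridPoint t m k / 2) • x (gridPoint t m k)) -
        Real.exp (gridPoint t m k / 2) • (w (gridPoint t m (k + 1)) - w (gridPoint t m k))‖ ≤
        ε / (t + 1) * (t / (m + 1)) := by
    intro k hk
    set a := gridPoint t m k
    set b := gridPoint t m (k + 1)
    have hab : a ≤ b := gridPoint_mono t m (Nat.le_succ k)
    have hbt : (b : ℝ) ≤ t := by
      rw [← gridPoint_last t m]
      exact_mod_cast gridPoint_mono t m (Nat.succ_le_of_lt (Finset.mem_range.1 hk))
    have hba : (b : ℝ) - a = t / (m + 1) := by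
      have : b = a + t / (m + 1) := gridPoint_succ t m k
      rw [this]
      push_cast
      ring
    have hab' : (a : ℝ) ≤ b := by exact_mod_cast hab
    have ha0 : (0 : ℝ) ≤ a := a.2
    rw [hstep a b hab, ← hba]
    have := intervalIntegral.norm_integral_le_of_norm_le_const (a := (a : ℝ)) (b := b)
      (C := ε / (t + 1))
      (f := fun s => (1 / 2 : ℝ) • (Real.exp (s / 2) • y b - Real.exp (a / 2) • y s))
      (fun s hs => ?_)
    · rwa [abs_of_nonneg (sub_nonneg.2 hab')] at this
    · rw [uIoc_of_le hab'] at hs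
      have h1 := hunif (s, (b : ℝ)) ⟨⟨ha0.trans hs.1.le, hs.2.trans hbt⟩, ⟨b.2, hbt⟩⟩
        ((a : ℝ), s) ⟨⟨ha0, hab'.trans hbt⟩, ⟨ha0.trans hs.1.le, hs.2.trans hbt⟩⟩ (by
          rw [Prod.dist_eq, max_lt_iff, Real.dist_eq, Real.dist_eq, abs_of_nonneg, abs_of_nonneg]
          · constructor <;> linarith [hs.1, hs.2]
          · linarith [hs.2]
          · linarith [hs.1])
      rw [dist_eq_norm] at h1
      rw [norm_smul]
      calc ‖(1 / 2 : ℝ)‖ * ‖Real.exp (s / 2) • y b - Real.exp (a / 2) • y s‖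
          ≤ 1 * (ε / (t + 1)) := by
            gcongr
            norm_num
        _ = ε / (t + 1) := one_mul _
  refine (norm_sum_le_of_le _ hbound).trans_lt ?_
  rw [Finset.sum_const, Finset.card_range, nsmul_eq_mul]
  push_cast
  have ht : (0 : ℝ) ≤ t := t.2
  have : ((m : ℝ) + 1) * (ε / (t + 1) * (t / (m + 1))) = ε * (t / (t + 1)) := by field_simp
  rw [this]
  have : (t : ℝ) / (t + 1) < 1 := by
    rw [div_lt_one (by positivity)]
    linarith
  nlinarith

/-- The variance of the Riemann sums of the noise. -/
noncomputable def noiseVar (t : ℝ≥0) (m : ℕ) : ℝ :=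
  ∑ k ∈ Finset.range (m + 1), Real.exp (gridPoint t m k / 2) ^ 2 * (t / (m + 1))

/-- These are left Riemann sums of `∫₀ᵗ exp s ds`. With mesh `h`, the inequalities `1 - exp (-h) ≤ h
≤ exp h - 1`, applied termwise to a telescoping sum, squeeze them between `exp (-h) * (exp t - 1)`
and `exp t - 1`. -/
lemma tendsto_noiseVar (t : ℝ≥0) : Tendsto (noiseVar t) atTop (𝓝 (Real.exp t - 1)) := by
  have htel : ∀ m, Real.exp t - 1 = ∑ k ∈ Finset.range (m + 1),
      (Real.exp (gridPoint t m (k + 1)) - Real.exp (gridPoint t m k)) := by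
    intro m
    rw [Finset.sum_range_sub (fun k => Real.exp (gridPoint t m k)), gridPoint_last,
      gridPoint_zero]
    simp
  have hsq : ∀ m k, Real.exp (gridPoint t m k / 2) ^ 2 = Real.exp (gridPoint t m k) := by
    intro m k
    rw [← Real.exp_nat_mul]
    congr 1
    push_cast
    ring
  have hstep : ∀ m k, Real.exp (gridPoint t m (k + 1)) =
      Real.exp (gridPoint t m k) * Real.exp (t / (m + 1)) := by
    intro m k
    rw [gridPoint_succ, ← Real.exp_add]
    push_cast
    rfl
  have hup : ∀ m, noiseVar t m ≤ Real.exp t - 1 := by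
    intro m
    rw [htel m]
    refine Finset.sum_le_sum fun k _ => ?_
    rw [hsq, hstep]
    have h1 := Real.add_one_le_exp ((t : ℝ) / (m + 1))
    have h2 := Real.exp_pos (gridPoint t m k)
    nlinarith
  have hlow : ∀ m : ℕ, Real.exp (-(t / (m + 1))) * (Real.exp t - 1) ≤ noiseVar t m := by
    intro m
    rw [htel m, Finset.mul_sum]
    refine Finset.sum_le_sum fun k _ => ?_
    rw [hsq, hstep]
    have h1 := Real.add_one_le_exp (-((t : ℝ) / (m + 1)))
    have h2 := Real.exp_pos (gridPoint t m k)
    have h3 : Real.exp (-((t : ℝ) / (m + 1))) * Real.exp (t / (m + 1)) = 1 := by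
      rw [← Real.exp_add]
      simp
    nlinarith
  have hmesh : Tendsto (fun m : ℕ => Real.exp (-((t : ℝ) / (m + 1))) * (Real.exp t - 1)) atTop
      (𝓝 (Real.exp t - 1)) := by
    have h0 : Tendsto (fun m : ℕ => (t : ℝ) / (m + 1)) atTop (𝓝 0) := by
      simpa [Function.comp_def] using
        (tendsto_const_div_atTop_nhds_zero_nat (t : ℝ)).comp (tendsto_add_atTop_nat 1)
    have := ((Real.continuous_exp.tendsto _).comp h0.neg).mul_const (Real.exp t - 1)
    simpa using this
  exact tendsto_of_tendsto_of_tendsto_of_le_of_le hmesh tendsto_const_nhds hlow hup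

variable {n : ℕ} {Ω : Type*} [MeasurableSpace Ω] {P : Measure Ω}

/-- Brownian increments over the grid are independent Gaussians, so the characteristic function is a
product of Gaussian ones and the variances add up to `noiseVar`. -/
lemma charFun_map_noiseSum_real [IsProbabilityMeasure P] {B : ℝ≥0 → Ω → ℝ}
    (hB : IsPreBrownianReal B P) (t : ℝ≥0) (m : ℕ) (ξ : ℝ) :
    charFun (P.map fun ω => noiseSum (fun s => B s ω) t m) ξ =
      Complex.exp (-(noiseVar t m * ξ ^ 2 / 2 : ℝ)) := by
  let inc : ℕ → Ω → ℝ := fun k ω =>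
    Real.exp (gridPoint t m k / 2) • (B (gridPoint t m (k + 1)) ω - B (gridPoint t m k) ω)
  have hind : iIndepFun inc P :=
    (hB.hasIndepIncrements.nat (gridPoint_mono t m)).comp
      (fun k x => Real.exp (gridPoint t m k / 2) • x) fun k => by fun_prop
  have hmeasB : ∀ k, AEMeasurable
      (fun ω => B (gridPoint t m (k + 1)) ω - B (gridPoint t m k) ω) P :=
    fun k => (hB.aemeasurable _).sub (hB.aemeasurable _)
  have hmeas : ∀ k, AEMeasurable (inc k) P := fun k => (hmeasB k).const_smul (Real.exp (gridPoint t m k / 2))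
  have hsum : (fun ω => noiseSum (fun s => B s ω) t m) = ∑ k ∈ Finset.range (m + 1), inc k := by
    ext ω
    simp [noiseSum, inc]
  rw [hsum, charFun_eq_charFunDual_toDualMap,
    iIndepFun.charFunDual_map_finsetSum_eq_prod (fun k _ => hmeas k) (hind.restrict _),
    Finset.prod_apply]
  simp only [← charFun_eq_charFunDual_toDualMap]
  have hk : ∀ k, charFun (P.map (inc k)) ξ = Complex.exp
      (-((Real.exp (gridPoint t m k / 2) ^ 2 * (t / (m + 1)) * ξ ^ 2 / 2 : ℝ) : ℂ)) := by
    intro k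
    have hl := hB.hasLaw_sub (gridPoint t m (k + 1)) (gridPoint t m k)
    have hmap : P.map (inc k) = (P.map
        (B (gridPoint t m (k + 1)) - B (gridPoint t m k))).map
          fun x => Real.exp (gridPoint t m k / 2) • x := by
      exact (AEMeasurable.map_map_of_aemeasurable (by fun_prop) (hmeasB k)).symm
    rw [hmap, charFun_map_smul, hl.map_eq, charFun_gaussianReal]
    have hdist : ((nndist (gridPoint t m (k + 1)).1 (gridPoint t m k).1 : ℝ≥0) : ℝ) =
        t / (m + 1) := by
      rw [coe_nndist, Real.dist_eq, gridPoint_succ]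
      have : (gridPoint t m k + t / (m + 1) : ℝ≥0).1 - (gridPoint t m k).1 = t / (m + 1) := by
        change ((gridPoint t m k + t / (m + 1) : ℝ≥0) : ℝ) - (gridPoint t m k : ℝ) = _
        push_cast
        ring
      rw [this, abs_of_nonneg (by positivity)]
    rw [hdist]
    congr 1
    push_cast
    simp only [smul_eq_mul]
    push_cast
    ring
  simp only [hk]
  rw [← Complex.exp_sum, noiseVar]
  congr 1
  push_cast
  rw [Finset.sum_mul, Finset.sum_div, ← Finset.sum_neg_distrib]

lemma IsBrownian.aemeasurable {W : ℝ≥0 → Ω → E n} (hW : IsBrownian W P) (t : ℝ≥0) :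
    AEMeasurable (W t) P := by
  have : AEMeasurable (fun ω i => W t ω i) P :=
    aemeasurable_pi_lambda _ fun i => (hW.coord i).toIsPreBrownianReal.aemeasurable t
  exact (by fun_prop : Measurable (WithLp.toLp 2 : (Fin n → ℝ) → E n)).comp_aemeasurable this

lemma measurable_noiseSum (t : ℝ≥0) (m : ℕ) :
    Measurable fun w : ℝ≥0 → E n => noiseSum w t m := by
  unfold noiseSum
  fun_prop

lemma IsBrownian.aemeasurable_noiseSum {W : ℝ≥0 → Ω → E n} (hW : IsBrownian W P) (t : ℝ≥0)
    (m : ℕ) : AEMeasurable (fun ω => noiseSum (fun s => W s ω) t m) P := by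
  have := hW.aemeasurable
  unfold noiseSum
  fun_prop

lemma charFun_map_noiseSum [IsProbabilityMeasure P] {W : ℝ≥0 → Ω → E n} (hW : IsBrownian W P)
    (t : ℝ≥0) (m : ℕ) (ξ : E n) :
    charFun (P.map fun ω => noiseSum (fun s => W s ω) t m) ξ =
      Complex.exp (-(noiseVar t m * ‖ξ‖ ^ 2 / 2 : ℝ)) := by
  have hcoord : ∀ i ω, noiseSum (fun s => W s ω) t m i = noiseSum (fun s => W s ω i) t m := by
    intro i ω
    simp [noiseSum]
  have hind : iIndepFun (fun i ω => noiseSum (fun s => W s ω i) t m) P :=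
    hW.indep.comp (fun _ w => noiseSum w t m) fun i => by
      unfold noiseSum
      fun_prop
  have hmeas : ∀ i, AEMeasurable (fun ω => noiseSum (fun s => W s ω i) t m) P := fun i => by
    have := (hW.coord i).toIsPreBrownianReal.aemeasurable
    unfold noiseSum
    fun_prop
  have := (iIndepFun_iff_charFun_pi hmeas).1 hind ξ
  have hfun : (fun ω => WithLp.toLp 2 fun i => noiseSum (fun s => W s ω i) t m) =
      fun ω => noiseSum (fun s => W s ω) t m := by
    ext ω i
    simp [hcoord]
  rw [hfun] at this
  rw [this]
  simp only [charFun_map_noiseSum_real (hW.coord _).toIsPreBrownianReal]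
  rw [← Complex.exp_sum, EuclideanSpace.real_norm_sq_eq, Finset.mul_sum, Finset.sum_div]
  push_cast
  rw [Finset.sum_neg_distrib]

/-- The ratio of noise and signal at time `t`. -/
noncomputable def noiseScale (t : ℝ) : ℝ := √(Real.exp t - 1)

lemma noiseScale_sq {t : ℝ} (ht : 0 ≤ t) : noiseScale t ^ 2 = Real.exp t - 1 :=
  Real.sq_sqrt (by linarith [Real.add_one_le_exp t])

/-- The law of the solution of the variance-preserving equation at time `t`. -/
lemma map_eq_map_prod [IsProbabilityMeasure P] {X W : ℝ≥0 → Ω → E n} (hX : IsVPProcess X W P)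
    (t : ℝ≥0) :
    P.map (X t) = ((P.map (X 0)).prod (stdGaussian (E n))).map
      fun p => Real.exp (-t / 2) • (p.1 + noiseScale t • p.2) := by
  have hX0 : IsProbabilityMeasure (P.map (X 0)) :=
    Measure.isProbabilityMeasure_map (hX.aemeasurable 0)
  have hXt : IsProbabilityMeasure (P.map (X t)) :=
    Measure.isProbabilityMeasure_map (hX.aemeasurable t)
  have : IsProbabilityMeasure ((stdGaussian (E n)).map fun z => noiseScale t • z) :=
    Measure.isProbabilityMeasure_map (by fun_prop)
  set a := Real.exp (-t / 2) with ha
  have hR : charFun (((P.map (X 0)).prod (stdGaussian (E n))).map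
      fun p => a • (p.1 + noiseScale t • p.2)) = fun ξ => charFun (P.map (X 0)) (a • ξ) *
        Complex.exp (-((Real.exp t - 1) * ‖a • ξ‖ ^ 2 / 2 : ℝ)) := by
    have hcomp : ((P.map (X 0)).prod (stdGaussian (E n))).map
        (fun p => a • (p.1 + noiseScale t • p.2)) =
        ((((P.map (X 0)).prod ((stdGaussian (E n)).map fun z => noiseScale t • z))).map
          (fun p => p.1 + p.2)).map fun x => a • x := by
      rw [Measure.map_map (by fun_prop) (by fun_prop)]
      have : (P.map (X 0)).prod ((stdGaussian (E n)).map fun z => noiseScale t • z) =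
          ((P.map (X 0)).prod (stdGaussian (E n))).map (Prod.map id fun z => noiseScale t • z) := by
        rw [← Measure.map_prod_map _ _ measurable_id (by fun_prop), Measure.map_id]
      rw [this, Measure.map_map (by fun_prop) (by fun_prop)]
      rfl
    ext ξ
    rw [hcomp, charFun_map_smul, charFun_map_add_prod_eq_mul, Pi.mul_apply, charFun_map_smul,
      charFun_stdGaussian]
    congr 2
    rw [norm_smul, Real.norm_of_nonneg (show 0 ≤ noiseScale t from Real.sqrt_nonneg _),
      ← noiseScale_sq (NNReal.coe_nonneg t)]
    push_cast
    ring
  refine Measure.ext_of_charFun ?_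
  rw [hR]
  ext ξ
  -- Pathwise, `X 0` plus the noise sums tends to `exp (t / 2) • X t`; testing at frequency `a • ξ`
  -- undoes the factor `exp (t / 2)`, and dominated convergence passes to characteristic functions.
  have hlim : Tendsto (fun m : ℕ => charFun (P.map fun ω => X 0 ω + noiseSum (fun s => W s ω) t m)
      (a • ξ)) atTop (𝓝 (charFun (P.map (X t)) ξ)) := by
    have hm : ∀ m, AEMeasurable (fun ω => X 0 ω + noiseSum (fun s => W s ω) t m) P := fun m =>
      (hX.aemeasurable 0).add (hX.brownian.aemeasurable_noiseSum t m)
    simp only [charFun_apply]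
    rw [integral_map (hX.aemeasurable t) (by fun_prop)]
    have : ∀ m, ∫ x, Complex.exp (inner ℝ x (a • ξ) * Complex.I)
        ∂(P.map fun ω => X 0 ω + noiseSum (fun s => W s ω) t m) =
        ∫ ω, Complex.exp (inner ℝ (X 0 ω + noiseSum (fun s => W s ω) t m) (a • ξ) * Complex.I) ∂P :=
      fun m => integral_map (hm m) (by fun_prop)
    simp only [this]
    refine tendsto_integral_of_dominated_convergence (fun _ => 1) (fun m => ?_)
      (integrable_const _) (fun m => ae_of_all _ fun ω => ?_) ?_
    · have hc : Continuous fun x : E n => Complex.exp (inner ℝ x (a • ξ) * Complex.I) := by fun_prop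
      exact (hc.measurable.comp_aemeasurable (hm m)).aestronglyMeasurable
    · rw [Complex.norm_exp_ofReal_mul_I]
    · filter_upwards [hX.continuous, hX.sde] with ω hc hs
      have h1 := (tendsto_noiseSum hc hs t).const_add (X 0 ω)
      rw [add_sub_cancel] at h1
      have hcont : Continuous fun x : E n => Complex.exp (inner ℝ x (a • ξ) * Complex.I) := by
        fun_prop
      have h2 := (hcont.tendsto _).comp h1
      have h3 : inner ℝ (Real.exp (t / 2) • X t ω) (a • ξ) = inner ℝ (X t ω) ξ := by
        rw [real_inner_smul_left, real_inner_smul_right, ← mul_assoc, ha, ← Real.exp_add]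
        ring_nf
        simp
      rwa [h3] at h2
  -- The same sequence, computed from independence of `X 0` and `W`, converges to the characteristic
  -- function of the explicit law.
  have hlim' : Tendsto (fun m : ℕ => charFun (P.map fun ω => X 0 ω + noiseSum (fun s => W s ω) t m)
      (a • ξ)) atTop (𝓝 (charFun (P.map (X 0)) (a • ξ) *
        Complex.exp (-((Real.exp t - 1) * ‖a • ξ‖ ^ 2 / 2 : ℝ)))) := by
    have hprod : ∀ m, charFun (P.map fun ω => X 0 ω + noiseSum (fun s => W s ω) t m) (a • ξ) =
        charFun (P.map (X 0)) (a • ξ) *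
          Complex.exp (-(noiseVar t m * ‖a • ξ‖ ^ 2 / 2 : ℝ)) := by
      intro m
      have hind : IndepFun (X 0) (fun ω => noiseSum (fun s => W s ω) t m) P :=
        hX.indep.comp measurable_id (measurable_noiseSum t m)
      rw [hind.charFun_map_fun_add_eq_mul (hX.aemeasurable 0)
        (hX.brownian.aemeasurable_noiseSum t m), Pi.mul_apply, charFun_map_noiseSum hX.brownian]
    simp only [hprod]
    refine Tendsto.const_mul _ ?_
    have hc : Continuous fun v : ℝ => Complex.exp (-(v * ‖a • ξ‖ ^ 2 / 2 : ℝ)) := by fun_prop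
    exact (hc.tendsto _).comp (tendsto_noiseVar t)
  exact tendsto_nhds_unique hlim hlim'

end Law

/-! ### Gaussian averages and their derivatives -/

section Average

variable {n : ℕ} {G : Type*} [NormedAddCommGroup G] [NormedSpace ℝ G]

/-- The average of `f` over the Gaussian measure with mean `c` and standard deviation `|b|`. -/
noncomputable def gaussAvg (f : E n → G) (c : E n) (b : ℝ) : G :=
  ∫ z, f (c - b • z) ∂stdGaussian (E n)

lemma integrable_comp_sub_smul {f : E n → G} (hf : Continuous f) {C : ℝ} (hC : ∀ x, ‖f x‖ ≤ C)
    (c : E n) (b : ℝ) : Integrable (fun z => f (c - b • z)) (stdGaussian (E n)) :=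
  Integrable.of_bound (hf.comp (by fun_prop)).aestronglyMeasurable C (ae_of_all _ fun _ => hC _)

lemma continuous_gaussAvg {f : E n → G} (hf : Continuous f) {C : ℝ} (hC : ∀ x, ‖f x‖ ≤ C) :
    Continuous fun q : E n × ℝ => gaussAvg f q.1 q.2 := by
  refine continuous_of_dominated (bound := fun _ => C)
    (fun q => (integrable_comp_sub_smul hf hC q.1 q.2).aestronglyMeasurable)
    (fun q => ae_of_all _ fun z => hC _) (integrable_const _) (ae_of_all _ fun z => ?_)
  exact hf.comp (by fun_prop)

/-- Differentiation under the integral, jointly in mean and standard deviation. Varying the latter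
brings out a factor `z`, so the dominating function is `C₁ * (1 + ‖z‖)`, integrable by the first
Gaussian moment. -/
lemma hasFDerivAt_gaussAvg {f : E n → G} (hf : ContDiff ℝ 1 f) {C₀ C₁ : ℝ}
    (h₀ : ∀ x, ‖f x‖ ≤ C₀) (h₁ : ∀ x, ‖fderiv ℝ f x‖ ≤ C₁) (q : E n × ℝ) :
    HasFDerivAt (fun q : E n × ℝ => gaussAvg f q.1 q.2)
      (∫ z, (fderiv ℝ f (q.1 - q.2 • z)).comp (ContinuousLinearMap.fst ℝ (E n) ℝ -
        (ContinuousLinearMap.snd ℝ (E n) ℝ).smulRight z) ∂stdGaussian (E n)) q ∧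
    Integrable (fun z => (fderiv ℝ f (q.1 - q.2 • z)).comp (ContinuousLinearMap.fst ℝ (E n) ℝ -
        (ContinuousLinearMap.snd ℝ (E n) ℝ).smulRight z)) (stdGaussian (E n)) := by
  have hC₁ : 0 ≤ C₁ := (norm_nonneg (fderiv ℝ f 0)).trans (h₁ 0)
  have hd : Continuous (fderiv ℝ f) := hf.continuous_fderiv one_ne_zero
  have hbound : ∀ (q : E n × ℝ) (z : E n),
      ‖(fderiv ℝ f (q.1 - q.2 • z)).comp (ContinuousLinearMap.fst ℝ (E n) ℝ -
        (ContinuousLinearMap.snd ℝ (E n) ℝ).smulRight z)‖ ≤ C₁ * (1 + ‖z‖) := by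
    intro q z
    refine (ContinuousLinearMap.opNorm_comp_le _ _).trans
      (mul_le_mul (h₁ _) ?_ (norm_nonneg _) hC₁)
    refine (norm_sub_le _ _).trans (add_le_add (ContinuousLinearMap.norm_fst_le ..) ?_)
    rw [ContinuousLinearMap.norm_smulRight_apply]
    exact mul_le_of_le_one_left (norm_nonneg _) (ContinuousLinearMap.norm_snd_le ..)
  have hint : Integrable (fun z : E n => C₁ * (1 + ‖z‖)) (stdGaussian (E n)) :=
    ((integrable_const 1).add integrable_norm_stdGaussian).const_mul _
  have hmeas : ∀ q : E n × ℝ, AEStronglyMeasurable (fun z =>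
      (fderiv ℝ f (q.1 - q.2 • z)).comp (ContinuousLinearMap.fst ℝ (E n) ℝ -
        (ContinuousLinearMap.snd ℝ (E n) ℝ).smulRight z)) (stdGaussian (E n)) := by
    intro q
    refine Continuous.aestronglyMeasurable ?_
    refine (hd.comp (by fun_prop)).clm_comp (continuous_const.sub ?_)
    exact (ContinuousLinearMap.smulRightL ℝ (E n × ℝ) (E n)
      (ContinuousLinearMap.snd ℝ (E n) ℝ)).continuous
  refine ⟨hasFDerivAt_integral_of_dominated_of_fderiv_le (s := univ)
    (F := fun (q : E n × ℝ) z => f (q.1 - q.2 • z))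
    (bound := fun z => C₁ * (1 + ‖z‖)) univ_mem
    (Eventually.of_forall fun q =>
      (integrable_comp_sub_smul hf.continuous h₀ q.1 q.2).aestronglyMeasurable)
    (integrable_comp_sub_smul hf.continuous h₀ q.1 q.2) (hmeas q)
    (ae_of_all _ fun z q _ => hbound q z) hint (ae_of_all _ fun z q _ => ?_),
    hint.mono' (hmeas q) (ae_of_all _ (hbound q))⟩
  have hin : HasFDerivAt (fun q : E n × ℝ => q.1 - q.2 • z) (ContinuousLinearMap.fst ℝ (E n) ℝ -
        (ContinuousLinearMap.snd ℝ (E n) ℝ).smulRight z) q :=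
    hasFDerivAt_fst.sub (hasFDerivAt_snd.smul_const z)
  exact (hf.differentiable one_ne_zero _).hasFDerivAt.comp q hin

lemma hasFDerivAt_gaussAvg_left {f : E n → G} (hf : ContDiff ℝ 1 f) {C₀ C₁ : ℝ}
    (h₀ : ∀ x, ‖f x‖ ≤ C₀) (h₁ : ∀ x, ‖fderiv ℝ f x‖ ≤ C₁) (c : E n) (b : ℝ) :
    HasFDerivAt (fun c => gaussAvg f c b) (gaussAvg (fderiv ℝ f) c b) c := by
  obtain ⟨h, hi⟩ := hasFDerivAt_gaussAvg hf h₀ h₁ (c, b)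
  have hin : HasFDerivAt (fun c : E n => (c, b)) (ContinuousLinearMap.inl ℝ (E n) ℝ) c :=
    hasFDerivAt_prodMk_left c b
  have := h.comp c hin
  convert! this using 1
  ext v
  rw [ContinuousLinearMap.comp_apply, ContinuousLinearMap.integral_apply hi, gaussAvg,
    ContinuousLinearMap.integral_apply
      (integrable_comp_sub_smul (hf.continuous_fderiv one_ne_zero) h₁ c b)]
  simp

lemma bilinTrace_gaussAvg {B : E n → E n →L[ℝ] E n →L[ℝ] ℝ} (hB : Continuous B) {C : ℝ}
    (hC : ∀ x, ‖B x‖ ≤ C) (c : E n) (b : ℝ) :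
    bilinTrace (gaussAvg B c b) = ∫ z, bilinTrace (B (c - b • z)) ∂stdGaussian (E n) := by
  have hi := integrable_comp_sub_smul (G := E n →L[ℝ] E n →L[ℝ] ℝ) hB hC c b
  unfold bilinTrace gaussAvg
  rw [integral_finsetSum _ fun i _ => (hi.apply_continuousLinearMap _).apply_continuousLinearMap _]
  refine Finset.sum_congr rfl fun i _ => ?_
  rw [ContinuousLinearMap.integral_apply hi,
    ContinuousLinearMap.integral_apply (hi.apply_continuousLinearMap _)]

/-- The derivative of a Gaussian average along a curve of means and standard deviations. -/
lemma hasDerivAt_gaussAvg {f : E n → ℝ} (hf : ContDiff ℝ 2 f) {C₀ C₁ C₂ : ℝ}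
    (h₀ : ∀ x, ‖f x‖ ≤ C₀) (h₁ : ∀ x, ‖fderiv ℝ f x‖ ≤ C₁)
    (h₂ : ∀ x, ‖fderiv ℝ (fderiv ℝ f) x‖ ≤ C₂) {c : ℝ → E n} {b : ℝ → ℝ} {c' : E n} {b' t : ℝ}
    (hc : HasDerivAt c c' t) (hb : HasDerivAt b b' t) :
    HasDerivAt (fun t => gaussAvg f (c t) (b t))
      (gaussAvg (fderiv ℝ f) (c t) (b t) c' +
        b' * b t * bilinTrace (gaussAvg (fderiv ℝ (fderiv ℝ f)) (c t) (b t))) t := by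
  have hf1 : ContDiff ℝ 1 f := hf.of_le (by norm_num)
  have hf2 : ContDiff ℝ 1 (fderiv ℝ f) := hf.fderiv_right (by norm_num)
  obtain ⟨h, hi⟩ := hasFDerivAt_gaussAvg hf1 h₀ h₁ (c t, b t)
  have := h.comp_hasDerivAt t (hc.prodMk hb)
  convert! this using 1
  have hd := integrable_comp_sub_smul (hf1.continuous_fderiv one_ne_zero) h₁ (c t) (b t)
  rw [ContinuousLinearMap.integral_apply hi, gaussAvg, ContinuousLinearMap.integral_apply hd,
    bilinTrace_gaussAvg (hf2.continuous_fderiv one_ne_zero) h₂]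
  have hz : Integrable (fun z => fderiv ℝ f (c t - b t • z) z) (stdGaussian (E n)) := by
    refine (integrable_norm_stdGaussian.const_mul C₁).mono' (Continuous.aestronglyMeasurable ?_)
      (ae_of_all _ fun z => ?_)
    · exact ((hf1.continuous_fderiv one_ne_zero).comp (by fun_prop)).clm_apply continuous_id
    · exact (ContinuousLinearMap.le_opNorm _ _).trans
        (mul_le_mul_of_nonneg_right (h₁ _) (norm_nonneg _))
  -- Stein's identity trades the factor `z`, which comes from the change of standard deviation, for
  -- a second derivative: this is where the Laplacian of the heat equation appears.
  have hs := integral_fderiv_apply_stdGaussian hf h₁ h₂ (c t) (b t)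
  have hsplit : ∀ z : E n, ((fderiv ℝ f (c t - b t • z)).comp (ContinuousLinearMap.fst ℝ (E n) ℝ -
        (ContinuousLinearMap.snd ℝ (E n) ℝ).smulRight z)) (c', b') =
      fderiv ℝ f (c t - b t • z) c' - b' * fderiv ℝ f (c t - b t • z) z := by
    intro z
    simp
  simp only [hsplit]
  rw [integral_sub (hd.apply_continuousLinearMap c') (hz.const_mul b'), integral_const_mul, hs]
  ring

end Average

/-! ### The explicit density and the Fokker-Planck equation -/

section Density

variable {n : ℕ}

/-- The density at time `t ≥ 0` of the solution of the variance-preserving equation with initial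
density `f`. -/
noncomputable def heatDensity (f : E n → ℝ) (t : ℝ) (x : E n) : ℝ :=
  Real.exp (n * t / 2) * gaussAvg f (Real.exp (t / 2) • x) (noiseScale t)

/-- The spatial derivative of `heatDensity`. -/
noncomputable def heatDeriv (f : E n → ℝ) (t : ℝ) (x : E n) : E n →L[ℝ] ℝ :=
  (Real.exp (n * t / 2) * Real.exp (t / 2)) •
    gaussAvg (fderiv ℝ f) (Real.exp (t / 2) • x) (noiseScale t)

/-- The second spatial derivative of `heatDensity`. -/
noncomputable def heatDeriv₂ (f : E n → ℝ) (t : ℝ) (x : E n) : E n →L[ℝ] E n →L[ℝ] ℝ :=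
  (Real.exp (n * t / 2) * Real.exp (t / 2) * Real.exp (t / 2)) •
    gaussAvg (fderiv ℝ (fderiv ℝ f)) (Real.exp (t / 2) • x) (noiseScale t)

lemma continuous_noiseScale : Continuous noiseScale := by
  unfold noiseScale
  fun_prop

lemma hasDerivAt_noiseScale {t : ℝ} (ht : 0 < t) :
    HasDerivAt noiseScale (Real.exp t / (2 * noiseScale t)) t := by
  have : Real.exp t - 1 ≠ 0 := by
    have := Real.add_one_lt_exp ht.ne'
    linarith
  exact ((Real.hasDerivAt_exp t).sub_const 1).sqrt this

lemma noiseScale_pos {t : ℝ} (ht : 0 < t) : 0 < noiseScale t :=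
  Real.sqrt_pos.2 (by linarith [Real.add_one_lt_exp ht.ne'])

lemma noiseScale_zero : noiseScale 0 = 0 := by simp [noiseScale]

lemma heatDensity_zero (f : E n → ℝ) : heatDensity f 0 = f := by
  ext x
  simp [heatDensity, gaussAvg, noiseScale_zero]

lemma continuous_comp_heat {G : Type*} [TopologicalSpace G] {g : E n × ℝ → G} (hg : Continuous g) :
    Continuous fun p : ℝ × E n => g (Real.exp (p.1 / 2) • p.2, noiseScale p.1) :=
  hg.comp (((Real.continuous_exp.comp (continuous_fst.div_const 2)).smul continuous_snd).prodMk
    (continuous_noiseScale.comp continuous_fst))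

/-- Bounds of a function and of its first two derivatives. -/
structure IsCb2 (f : E n → ℝ) : Prop where
  contDiff : ContDiff ℝ 2 f
  bound₀ : ∃ C, ∀ x, ‖f x‖ ≤ C
  bound₁ : ∃ C, ∀ x, ‖fderiv ℝ f x‖ ≤ C
  bound₂ : ∃ C, ∀ x, ‖fderiv ℝ (fderiv ℝ f) x‖ ≤ C

lemma MemCb.isCb2 {f : E n → ℝ} (h : MemCb 2 f) : IsCb2 f where
  contDiff := h.1
  bound₀ := by simpa using h.2 0 (by norm_num)
  bound₁ := by simpa [norm_iteratedFDeriv_one] using h.2 1 (by norm_num)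
  bound₂ := by
    obtain ⟨C, hC⟩ := h.2 2 le_rfl
    refine ⟨C, fun x => ?_⟩
    have h2 : ‖iteratedFDeriv ℝ 1 (fderiv ℝ f) x‖ = ‖iteratedFDeriv ℝ 2 f x‖ :=
      norm_iteratedFDeriv_fderiv
    rw [← norm_iteratedFDeriv_one, h2]
    exact hC x

namespace IsCb2

variable {f : E n → ℝ}

lemma contDiff_one (h : IsCb2 f) : ContDiff ℝ 1 f := h.contDiff.of_le (by norm_num)

lemma contDiff_fderiv (h : IsCb2 f) : ContDiff ℝ 1 (fderiv ℝ f) :=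
  h.contDiff.fderiv_right (by norm_num)

lemma continuous_fderiv (h : IsCb2 f) : Continuous (fderiv ℝ f) := h.contDiff_fderiv.continuous

lemma continuous_fderiv₂ (h : IsCb2 f) : Continuous (fderiv ℝ (fderiv ℝ f)) :=
  h.contDiff_fderiv.continuous_fderiv one_ne_zero

/-- No kernel that degenerates at `t = 0` is involved: the Gaussian measure is fixed and time enters
through the argument of `f`, which is continuous even where `noiseScale` vanishes. -/
lemma continuous_heatDensity (h : IsCb2 f) :
    Continuous fun p : ℝ × E n => heatDensity f p.1 p.2 := by
  obtain ⟨C, hC⟩ := h.bound₀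
  exact (by fun_prop : Continuous fun p : ℝ × E n => Real.exp (n * p.1 / 2)).mul
    (continuous_comp_heat (continuous_gaussAvg h.contDiff.continuous hC))

lemma continuous_heatDeriv (h : IsCb2 f) :
    Continuous fun p : ℝ × E n => heatDeriv f p.1 p.2 := by
  obtain ⟨C, hC⟩ := h.bound₁
  exact (by fun_prop : Continuous fun p : ℝ × E n =>
    Real.exp (n * p.1 / 2) * Real.exp (p.1 / 2)).smul
    (continuous_comp_heat (continuous_gaussAvg h.continuous_fderiv hC))

lemma continuous_heatDeriv₂ (h : IsCb2 f) :
    Continuous fun p : ℝ × E n => heatDeriv₂ f p.1 p.2 := by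
  obtain ⟨C, hC⟩ := h.bound₂
  exact (by fun_prop : Continuous fun p : ℝ × E n =>
    Real.exp (n * p.1 / 2) * Real.exp (p.1 / 2) * Real.exp (p.1 / 2)).smul
    (continuous_comp_heat (continuous_gaussAvg h.continuous_fderiv₂ hC))

lemma hasFDerivAt_heatDensity (h : IsCb2 f) (t : ℝ) (x : E n) :
    HasFDerivAt (heatDensity f t) (heatDeriv f t x) x := by
  obtain ⟨C₀, h₀⟩ := h.bound₀
  obtain ⟨C₁, h₁⟩ := h.bound₁
  have := ((hasFDerivAt_gaussAvg_left h.contDiff_one h₀ h₁ (Real.exp (t / 2) • x)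
    (noiseScale t)).comp x ((hasFDerivAt_id x).const_smul (Real.exp (t / 2)))).const_mul
      (Real.exp (n * t / 2))
  convert! this using 1
  ext v
  simp [heatDeriv]
  ring

lemma hasFDerivAt_heatDeriv (h : IsCb2 f) (t : ℝ) (x : E n) :
    HasFDerivAt (heatDeriv f t) (heatDeriv₂ f t x) x := by
  obtain ⟨C₁, h₁⟩ := h.bound₁
  obtain ⟨C₂, h₂⟩ := h.bound₂
  have := ((hasFDerivAt_gaussAvg_left h.contDiff_fderiv h₁ h₂ (Real.exp (t / 2) • x)
    (noiseScale t)).comp x ((hasFDerivAt_id x).const_smul (Real.exp (t / 2)))).const_smul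
      (Real.exp (n * t / 2) * Real.exp (t / 2))
  convert! this using 1
  ext v w
  simp [heatDeriv₂]
  ring

lemma heatDensity_pos (h : IsCb2 f) (hpos : ∀ x, 0 < f x) (t : ℝ) (x : E n) :
    0 < heatDensity f t x := by
  obtain ⟨C₀, h₀⟩ := h.bound₀
  refine mul_pos (Real.exp_pos _) ?_
  rw [gaussAvg, integral_pos_iff_support_of_nonneg (fun _ => (hpos _).le)
    (integrable_comp_sub_smul h.contDiff.continuous h₀ _ _)]
  have : (Function.support fun z : E n => f (Real.exp (t / 2) • x - noiseScale t • z)) = univ :=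
    eq_univ_of_forall fun z => (hpos _).ne'
  rw [this]
  simp

/-- The Fokker-Planck equation, along a curve. -/
lemma hasDerivAt_heatDensity (h : IsCb2 f) {γ : ℝ → E n} {γ' : E n} {t : ℝ} (ht : 0 < t)
    (hγ : HasDerivAt γ γ' t) :
    HasDerivAt (fun t => heatDensity f t (γ t))
      (n / 2 * heatDensity f t (γ t) + heatDeriv f t (γ t) ((1 / 2 : ℝ) • γ t + γ') +
        1 / 2 * bilinTrace (heatDeriv₂ f t (γ t))) t := by
  obtain ⟨C₀, h₀⟩ := h.bound₀
  obtain ⟨C₁, h₁⟩ := h.bound₁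
  obtain ⟨C₂, h₂⟩ := h.bound₂
  have hexp : HasDerivAt (fun t : ℝ => Real.exp (t / 2)) (Real.exp (t / 2) * (1 / 2)) t :=
    ((hasDerivAt_id' t).div_const 2).exp
  have hexpn : HasDerivAt (fun t : ℝ => Real.exp (n * t / 2)) (Real.exp (n * t / 2) * (n / 2)) t :=
    by simpa using! (((hasDerivAt_id' t).const_mul (n : ℝ)).div_const 2).exp
  have hG := hasDerivAt_gaussAvg h.contDiff h₀ h₁ h₂ (hexp.smul hγ) (hasDerivAt_noiseScale ht)
  have := hexpn.mul hG
  convert! this using 1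
  have hb := (noiseScale_pos ht).ne'
  -- The derivative of `noiseScale` is singular at `0`, but only its product with `noiseScale`
  -- enters the equation.
  have hbb : Real.exp t / (2 * noiseScale t) * noiseScale t = 1 / 2 * Real.exp t := by
    field_simp
  have htr : ∀ (r : ℝ) (B : E n →L[ℝ] E n →L[ℝ] ℝ), bilinTrace (r • B) = r * bilinTrace B := by
    intro r B
    simp [bilinTrace, Finset.mul_sum]
  rw [hbb, heatDeriv₂, htr, heatDeriv, heatDensity]
  simp only [smul_apply, map_add, map_smul, smul_eq_mul, Pi.smul_apply']
  have he : Real.exp (t / 2) * Real.exp (t / 2) = Real.exp t := by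
    rw [← Real.exp_add, add_halves]
  rw [mul_assoc (Real.exp (n * t / 2)) (Real.exp (t / 2)) (Real.exp (t / 2)), he]
  ring

end IsCb2

end Density

/-! ### Identification of the marginals and of the score -/

section Marginal

variable {n : ℕ} {f : E n → ℝ}

/-- Finiteness of `μ` gives equality almost everywhere, and continuity upgrades it to every point
since Lebesgue measure charges open sets. Thus the choice made in `density` is harmless. -/
lemma IsContDensity.unique {μ : Measure (E n)} {f g : E n → ℝ} (hμ : IsFiniteMeasure μ)
    (hf : IsContDensity μ f) (hg : IsContDensity μ g) : f = g := by
  have hff : ∫⁻ x, ENNReal.ofReal (f x) ≠ ∞ := by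
    have h := measure_ne_top μ univ
    rwa [hf.2.2, toMeasure, withDensity_apply _ MeasurableSet.univ, Measure.restrict_univ] at h
  have h := (withDensity_eq_iff (μ := volume) (f := fun x => ENNReal.ofReal (f x))
    (g := fun x => ENNReal.ofReal (g x)) hf.1.measurable.ennreal_ofReal.aemeasurable
    hg.1.measurable.ennreal_ofReal.aemeasurable hff).1 (hf.2.2.symm.trans hg.2.2)
  refine hf.1.ae_eq_iff_eq volume hg.1 |>.1 ?_
  filter_upwards [h] with x hx
  exact (ENNReal.ofReal_eq_ofReal_iff (hf.2.1 x) (hg.2.1 x)).1 hx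

lemma density_eq {μ : Measure (E n)} [hμ : IsFiniteMeasure μ] {f : E n → ℝ}
    (hf : IsContDensity μ f) : density μ = f := by
  have hex : ∃ f, IsContDensity μ f := ⟨f, hf⟩
  rw [density, dif_pos hex]
  exact hex.choose_spec.unique hμ hf

lemma lintegral_smul_add {a : ℝ} (ha : 0 < a) (w : E n) {h : E n → ℝ≥0∞} (hh : Measurable h) :
    ∫⁻ y, h (a • (y + w)) = ENNReal.ofReal ((a ^ n)⁻¹) * ∫⁻ x, h x := by
  rw [lintegral_add_right_eq_self (fun y => h (a • y)) w]
  have := lintegral_map (μ := (volume : Measure (E n))) hh (measurable_const_smul a)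
  rw [Measure.map_addHaar_smul _ ha.ne', lintegral_smul_measure, finrank_euclideanSpace,
    Fintype.card_fin, abs_of_pos (by positivity), smul_eq_mul] at this
  exact this.symm

/-- For fixed noise `z`, substitute `x = exp (-t / 2) • (y + noiseScale t • z)`, whose Jacobian
gives the factor `exp (n * t / 2)`; Tonelli then moves the Gaussian integral inside. -/
lemma IsCb2.map_prod_eq_toMeasure (h : IsCb2 f) (hpos : ∀ x, 0 < f x)
    [SFinite (toMeasure f)] (t : ℝ) :
    ((toMeasure f).prod (stdGaussian (E n))).map
      (fun p => Real.exp (-t / 2) • (p.1 + noiseScale t • p.2)) =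
      toMeasure (heatDensity f t) := by
  obtain ⟨C₀, h₀⟩ := h.bound₀
  have hfc := h.contDiff.continuous
  have hfm : Measurable fun x => ENNReal.ofReal (f x) := hfc.measurable.ennreal_ofReal
  refine Measure.ext_of_lintegral _ fun g hg => ?_
  have hgm : Measurable fun p : E n × E n => g (Real.exp (-t / 2) • (p.1 + noiseScale t • p.2)) :=
    hg.comp (by fun_prop)
  have hcm : Measurable fun x : E n => ENNReal.ofReal (heatDensity f t x) :=
    (h.continuous_heatDensity.comp (continuous_const.prodMk continuous_id)).measurable.ennreal_ofReal
  rw [lintegral_map hg (by fun_prop), lintegral_prod_symm _ hgm.aemeasurable,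
    toMeasure.eq_1 (heatDensity f t), lintegral_withDensity_eq_lintegral_mul _ hcm hg]
  have hinner : ∀ z : E n, ∫⁻ y, g (Real.exp (-t / 2) • (y + noiseScale t • z)) ∂toMeasure f =
      ∫⁻ x, ENNReal.ofReal (Real.exp (n * t / 2)) *
        (g x * ENNReal.ofReal (f (Real.exp (t / 2) • x - noiseScale t • z))) := by
    intro z
    have hk : Measurable fun x : E n =>
        g x * ENNReal.ofReal (f (Real.exp (t / 2) • x - noiseScale t • z)) :=
      hg.mul (hfc.comp (by fun_prop)).measurable.ennreal_ofReal
    have hgy : Measurable fun y : E n => g (Real.exp (-t / 2) • (y + noiseScale t • z)) :=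
      hg.comp (by fun_prop)
    rw [toMeasure, lintegral_withDensity_eq_lintegral_mul _ hfm hgy, lintegral_const_mul _ hk]
    have := lintegral_smul_add (Real.exp_pos (-t / 2)) (noiseScale t • z) hk
    have he : (Real.exp (-t / 2) ^ n)⁻¹ = Real.exp (n * t / 2) := by
      rw [← Real.exp_nat_mul, ← Real.exp_neg]
      congr 1
      ring
    rw [he] at this
    rw [← this]
    refine lintegral_congr fun y => ?_
    have hy : Real.exp (t / 2) • Real.exp (-t / 2) • (y + noiseScale t • z) - noiseScale t • z =
        y := by
      rw [smul_smul, ← Real.exp_add, show t / 2 + -t / 2 = 0 by ring, Real.exp_zero, one_smul,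
        add_sub_cancel_right]
    rw [hy, Pi.mul_apply, mul_comm]
  simp only [hinner]
  rw [lintegral_lintegral_swap]
  · refine lintegral_congr fun x => ?_
    have hm : Measurable fun z : E n =>
        ENNReal.ofReal (f (Real.exp (t / 2) • x - noiseScale t • z)) :=
      (hfc.comp (by fun_prop)).measurable.ennreal_ofReal
    rw [lintegral_const_mul _ (hm.const_mul _), lintegral_const_mul _ hm, Pi.mul_apply,
      heatDensity, ENNReal.ofReal_mul (Real.exp_pos _).le, gaussAvg,
      ofReal_integral_eq_lintegral_ofReal (integrable_comp_sub_smul hfc h₀ _ _)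
        (ae_of_all _ fun _ => (hpos _).le)]
    ring
  · refine Measurable.aemeasurable ?_
    exact ((hg.comp measurable_snd).mul
      (hfc.comp (by fun_prop : Continuous fun p : E n × E n =>
        Real.exp (t / 2) • p.2 - noiseScale t • p.1)).measurable.ennreal_ofReal).const_mul _

variable {Ω : Type*} [MeasurableSpace Ω] {P : Measure Ω} [IsProbabilityMeasure P]
  {X W : ℝ≥0 → Ω → E n}

lemma map_eq_toMeasure (hX : IsVPProcess X W P) (hlaw : HasLaw (X 0) (toMeasure f) P)
    (h : IsCb2 f) (hpos : ∀ x, 0 < f x) (t : ℝ≥0) :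
    P.map (X t) = toMeasure (heatDensity f t) := by
  have : IsProbabilityMeasure (toMeasure f) := hlaw.map_eq ▸
    Measure.isProbabilityMeasure_map (hX.aemeasurable 0)
  rw [map_eq_map_prod hX t, hlaw.map_eq, h.map_prod_eq_toMeasure hpos]

/-- The maximum reflects `Real.toNNReal`, which freezes the process at time `0` for negative `t`. -/
lemma marginal_eq (hX : IsVPProcess X W P) (hlaw : HasLaw (X 0) (toMeasure f) P)
    (h : IsCb2 f) (hpos : ∀ x, 0 < f x) (t : ℝ) :
    marginal X P t = heatDensity f (max t 0) := by
  have : IsProbabilityMeasure (P.map (X t.toNNReal)) :=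
    Measure.isProbabilityMeasure_map (hX.aemeasurable _)
  rw [marginal, ← Real.coe_toNNReal']
  exact density_eq ⟨h.continuous_heatDensity.comp (continuous_const.prodMk continuous_id),
    fun x => (h.heatDensity_pos hpos _ x).le, map_eq_toMeasure hX hlaw h hpos _⟩

/-- The identification of linear forms with vectors. -/
noncomputable def riesz (n : ℕ) : (E n →L[ℝ] ℝ) →L[ℝ] E n where
  toFun := (InnerProductSpace.toDual ℝ (E n)).symm
  map_add' := map_add _
  map_smul' c v := by simp
  cont := (InnerProductSpace.toDual ℝ (E n)).symm.continuous

lemma inner_riesz (l : E n →L[ℝ] ℝ) (v : E n) : inner ℝ v (riesz n l) = l v := by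
  rw [real_inner_comm]
  exact InnerProductSpace.toDual_symm_apply

/-- The score of `heatDensity`. -/
noncomputable def heatScore (f : E n → ℝ) (t : ℝ) (x : E n) : E n :=
  (heatDensity f t x)⁻¹ • riesz n (heatDeriv f t x)

/-- The spatial derivative of `heatScore`. -/
noncomputable def heatScoreDeriv (f : E n → ℝ) (t : ℝ) (x : E n) : E n →L[ℝ] E n :=
  (heatDensity f t x)⁻¹ •
      (riesz n).comp (heatDeriv₂ f t x) +
    (-(heatDensity f t x ^ 2)⁻¹ • heatDeriv f t x).smulRight
      (riesz n (heatDeriv f t x))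

lemma score_eq (hX : IsVPProcess X W P) (hlaw : HasLaw (X 0) (toMeasure f) P)
    (h : IsCb2 f) (hpos : ∀ x, 0 < f x) (t : ℝ) :
    score X P t = heatScore f (max t 0) := by
  ext1 x
  have hlog := (h.hasFDerivAt_heatDensity (max t 0) x).log (h.heatDensity_pos hpos _ x).ne'
  rw [score, marginal_eq hX hlaw h hpos, gradient, hlog.fderiv, heatScore, ← map_smul]
  rfl

namespace IsCb2

lemma continuous_heatScore (h : IsCb2 f) (hpos : ∀ x, 0 < f x) :
    Continuous fun p : ℝ × E n => heatScore f p.1 p.2 :=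
  (h.continuous_heatDensity.inv₀ fun _ => (h.heatDensity_pos hpos _ _).ne').smul
    ((riesz n).continuous.comp h.continuous_heatDeriv)

lemma hasFDerivAt_heatScore (h : IsCb2 f) (hpos : ∀ x, 0 < f x) (t : ℝ) (x : E n) :
    HasFDerivAt (heatScore f t) (heatScoreDeriv f t x) x := by
  have hne := (h.heatDensity_pos hpos t x).ne'
  have h1 : HasFDerivAt (fun x => (heatDensity f t x)⁻¹)
      (-(heatDensity f t x ^ 2)⁻¹ • heatDeriv f t x) x :=
    (hasDerivAt_inv hne).comp_hasFDerivAt x (h.hasFDerivAt_heatDensity t x)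
  have h2 : HasFDerivAt
      (fun x => riesz n (heatDeriv f t x))
      ((riesz n).comp (heatDeriv₂ f t x)) x :=
    (riesz n).hasFDerivAt.comp x (h.hasFDerivAt_heatDeriv t x)
  exact h1.smul h2

lemma continuous_heatScoreDeriv (h : IsCb2 f) (hpos : ∀ x, 0 < f x) :
    Continuous fun p : ℝ × E n => heatScoreDeriv f p.1 p.2 := by
  have hne : ∀ p : ℝ × E n, heatDensity f p.1 p.2 ≠ 0 := fun p => (h.heatDensity_pos hpos _ _).ne'
  refine ((h.continuous_heatDensity.inv₀ hne).smul
    (continuous_const.clm_comp h.continuous_heatDeriv₂)).add ?_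
  refine (ContinuousLinearMap.smulRightL ℝ (E n) (E n)).continuous₂.comp (Continuous.prodMk ?_ ?_)
  · exact (((h.continuous_heatDensity.pow 2).inv₀ fun p => pow_ne_zero 2 (hne p)).neg).smul
      h.continuous_heatDeriv
  · exact (riesz n).continuous.comp h.continuous_heatDeriv

/-- This is `Δ log p = Δp / p - |∇p|² / p²`, with one factor `∇p / p` written as the score. -/
lemma trace_heatScoreDeriv (t : ℝ) (x : E n) :
    LinearMap.trace ℝ (E n) (heatScoreDeriv f t x) =
      (heatDensity f t x)⁻¹ * bilinTrace (heatDeriv₂ f t x) -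
        (heatDensity f t x)⁻¹ * heatDeriv f t x (heatScore f t x) := by
  let e := EuclideanSpace.basisFun (Fin n) ℝ
  set d := heatDeriv f t x with hd
  set g := riesz n d with hg
  rw [LinearMap.trace_eq_sum_inner _ e]
  have hterm : ∀ i, inner ℝ (e i) (heatScoreDeriv f t x (e i)) =
      (heatDensity f t x)⁻¹ * heatDeriv₂ f t x (e i) (e i) -
        (heatDensity f t x ^ 2)⁻¹ * (inner ℝ (e i) g * d (e i)) := by
    intro i
    simp only [heatScoreDeriv, ← hd, ← hg, add_apply, smul_apply,
      ContinuousLinearMap.smulRight_apply, ContinuousLinearMap.comp_apply, inner_add_right,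
      inner_smul_right, smul_eq_mul]
    rw [inner_riesz]
    ring
  have hsum : ∑ i, inner ℝ (e i) g * d (e i) = d g := by
    conv_rhs => rw [← e.sum_repr' g]
    rw [map_sum]
    exact Finset.sum_congr rfl fun i _ => by rw [map_smul, smul_eq_mul]
  simp only [ContinuousLinearMap.coe_coe, hterm]
  rw [Finset.sum_sub_distrib, ← Finset.mul_sum, ← Finset.mul_sum, hsum, heatScore, map_smul,
    ← hd, ← hg, smul_eq_mul, bilinTrace, sq, mul_inv]
  ring

end IsCb2

end Marginal

/-! ### The probability flow as a transport of densities -/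

section Transport

variable {n : ℕ} {f : E n → ℝ}

/-- The velocity field of the probability flow, frozen for negative times. -/
noncomputable def heatVelocity (f : E n → ℝ) (t : ℝ) (x : E n) : E n :=
  -(1 / 2 : ℝ) • x - (1 / 2 : ℝ) • heatScore f (max t 0) x

/-- The spatial derivative of `heatVelocity`. -/
noncomputable def heatVelocityDeriv (f : E n → ℝ) (t : ℝ) (x : E n) : E n →L[ℝ] E n :=
  -(1 / 2 : ℝ) • ContinuousLinearMap.id ℝ (E n) - (1 / 2 : ℝ) • heatScoreDeriv f (max t 0) x

lemma IsCb2.isC1Field (h : IsCb2 f) (hpos : ∀ x, 0 < f x) {L : ℝ → ℝ}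
    (hscore : ∀ t, 0 ≤ t → ∀ x, ‖heatScoreDeriv f t x‖ ≤ L t)
    (hL : ∀ T, 0 < T → IntervalIntegrable (fun t => 1 + L t) volume 0 T) :
    IsC1Field (heatVelocity f) (heatVelocityDeriv f) (fun t => 1 / 2 * (1 + L (max t 0))) where
  continuous := by
    have : Continuous fun p : ℝ × E n => heatScore f (max p.1 0) p.2 :=
      (h.continuous_heatScore hpos).comp (f := fun p : ℝ × E n => (max p.1 0, p.2)) (by fun_prop)
    exact (continuous_snd.const_smul (-(1 / 2 : ℝ))).sub (this.const_smul (1 / 2 : ℝ))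
  hasFDerivAt t x := ((hasFDerivAt_id x).const_smul (-(1 / 2 : ℝ))).sub
    ((h.hasFDerivAt_heatScore hpos (max t 0) x).const_smul (1 / 2 : ℝ))
  continuous_deriv := by
    have : Continuous fun p : ℝ × E n => heatScoreDeriv f (max p.1 0) p.2 :=
      (h.continuous_heatScoreDeriv hpos).comp (f := fun p : ℝ × E n => (max p.1 0, p.2))
        (by fun_prop)
    exact continuous_const.sub (this.const_smul (1 / 2 : ℝ))
  norm_le t x := by
    refine (norm_sub_le _ _).trans ?_
    rw [norm_smul, norm_smul, mul_add]
    refine add_le_add ?_ ?_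
    · rw [norm_neg, Real.norm_of_nonneg (by norm_num)]
      gcongr
      exact ContinuousLinearMap.norm_id_le
    · rw [Real.norm_of_nonneg (by norm_num)]
      gcongr
      exact hscore _ (le_max_right _ _) x
  integrable := by
    have key : ∀ T, IntervalIntegrable (fun t => 1 + L (max t 0)) volume 0 T := by
      intro T
      rcases lt_or_ge 0 T with hT | hT
      · refine (hL T hT).congr fun t ht => ?_
        rw [uIoc_of_le hT.le] at ht
        simp only [max_eq_left ht.1.le]
      · refine (intervalIntegrable_const (c := 1 + L 0)).congr fun t ht => ?_
        rw [uIoc_of_ge hT] at ht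
        simp only [max_eq_right ht.2]
    exact fun a b => ((key a).symm.trans (key b)).const_mul _

/-- Conservation of mass along the probability flow. -/
lemma IsCb2.heatDensity_flow_mul_det (h : IsCb2 f) (hpos : ∀ x, 0 < f x) {k : ℝ → ℝ}
    (hV : IsC1Field (heatVelocity f) (heatVelocityDeriv f) k) (x : E n) {J : ℝ → E n →L[ℝ] E n}
    (hJ0 : J 0 = ContinuousLinearMap.id ℝ (E n))
    (hJ : ∀ t, HasDerivAt J ((heatVelocityDeriv f t (hV.flow 0 t x)).comp (J t)) t)
    {T : ℝ} (hT : 0 ≤ T) :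
    heatDensity f T (hV.flow 0 T x) * (J T).det = f x := by
  rcases hT.eq_or_lt with rfl | hT
  · rw [hV.flow_self, hJ0, heatDensity_zero]
    simp [ContinuousLinearMap.det]
  let ψ : ℝ → ℝ := fun t => heatDensity f t (hV.flow 0 t x) * (J t).det
  have hγ := hV.isIntegralCurve_flow 0 x
  have hJd : ∀ t, HasDerivAt (fun t => (J t).det) (LinearMap.trace ℝ (E n)
      (heatVelocityDeriv f t (hV.flow 0 t x)) * (J t).det) t := fun t =>
    hasDerivAt_det_of_hasDerivAt_mul (hJ t)
  have hcont : ContinuousOn ψ (Icc 0 T) := by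
    refine Continuous.continuousOn (Continuous.mul ?_ ?_)
    · exact h.continuous_heatDensity.comp (continuous_id.prodMk hγ.continuous)
    · exact continuous_iff_continuousAt.2 fun t => (hJd t).continuousAt
  -- Only the open interval is available, because `noiseScale` is not differentiable at `0`;
  -- continuity on the closed interval and the mean value theorem suffice.
  have hder : ∀ t ∈ Ioo 0 T, HasDerivAt ψ 0 t := by
    intro t ht
    have h1 := h.hasDerivAt_heatDensity ht.1 (hγ t)
    have h2 := h1.mul (hJd t)
    convert! h2 using 1
    set y := hV.flow 0 t x
    have hne := (h.heatDensity_pos hpos t y).ne'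
    have hmax : max t 0 = t := max_eq_left ht.1.le
    have htr : LinearMap.trace ℝ (E n) (heatVelocityDeriv f t y) = -(n / 2) -
        1 / 2 * ((heatDensity f t y)⁻¹ * bilinTrace (heatDeriv₂ f t y) -
          (heatDensity f t y)⁻¹ * heatDeriv f t y (heatScore f t y)) := by
      have : ((heatVelocityDeriv f t y : E n →L[ℝ] E n) : E n →ₗ[ℝ] E n) =
          -(1 / 2 : ℝ) • LinearMap.id - (1 / 2 : ℝ) • (heatScoreDeriv f t y : E n →ₗ[ℝ] E n) := by
        ext v
        simp [heatVelocityDeriv, hmax]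
      rw [this, map_sub, map_smul, map_smul, IsCb2.trace_heatScoreDeriv, LinearMap.trace_id,
        finrank_euclideanSpace, Fintype.card_fin]
      simp only [smul_eq_mul]
      ring
    -- The linear drift cancels in the transport term. What remains of the Fokker-Planck equation is
    -- exactly minus the density times the divergence of the velocity.
    have hvel : (1 / 2 : ℝ) • y + heatVelocity f t y = -(1 / 2 : ℝ) • heatScore f t y := by
      rw [heatVelocity, hmax]
      module
    rw [hvel, htr, map_smul, smul_eq_mul]
    field_simp
    ring
  obtain ⟨c, hc, hslope⟩ := exists_hasDerivAt_eq_slope ψ (fun _ => 0) hT hcont hder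
  have : ψ T = ψ 0 := by
    have hT0 : T - 0 ≠ 0 := by simpa using hT.ne'
    field_simp at hslope
    linarith
  change ψ T = f x
  rw [this]
  simp only [ψ]
  rw [hV.flow_self, hJ0, heatDensity_zero]
  simp [ContinuousLinearMap.det]

lemma IsCb2.exists_flow_deriv (h : IsCb2 f) (hpos : ∀ x, 0 < f x) {k : ℝ → ℝ}
    (hV : IsC1Field (heatVelocity f) (heatVelocityDeriv f) k) {T : ℝ} (hT : 0 ≤ T) (x : E n) :
    ∃ J : E n →L[ℝ] E n, HasStrictFDerivAt (hV.flow 0 T) J x ∧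
      heatDensity f T (hV.flow 0 T x) * J.det = f x := by
  obtain ⟨J, hJ0, hJ⟩ := hV.exists_variation (hV.isIntegralCurve_flow 0 x).continuous
  exact ⟨J T, hV.hasStrictFDerivAt_flow hT x hJ0 hJ,
    h.heatDensity_flow_mul_det hpos hV x hJ0 hJ hT⟩

/-- Conservation of mass together with `0 < f` rules out a vanishing Jacobian determinant, so the
inverse homeomorphism is `C¹`. -/
lemma IsCb2.isC1Diffeo_flow (h : IsCb2 f) (hpos : ∀ x, 0 < f x) {k : ℝ → ℝ}
    (hV : IsC1Field (heatVelocity f) (heatVelocityDeriv f) k) {T : ℝ} (hT : 0 ≤ T) :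
    IsC1Diffeo (hV.flow 0 T) := by
  choose J hJ hdet using h.exists_flow_deriv hpos hV hT
  have hJne : ∀ x, (J x).det ≠ 0 := fun x h0 => by
    have := hdet x
    rw [h0, mul_zero] at this
    exact (hpos x).ne this
  have hC1 : ContDiff ℝ 1 (hV.flow 0 T) := contDiff_one_of_hasStrictFDerivAt hJ
  refine ⟨(hV.flowHomeomorph 0 T).bijective, hC1, ?_⟩
  have hinv : Function.invFun (hV.flow 0 T) = (hV.flowHomeomorph 0 T).symm :=
    Function.invFun_eq_of_injective_of_rightInverse (hV.flowHomeomorph 0 T).injective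
      (hV.flowHomeomorph 0 T).right_inv
  rw [hinv]
  exact (hV.flowHomeomorph 0 T).contDiff_symm
    (f₀' := fun x => (J x).toContinuousLinearEquivOfDetNeZero (hJne x))
    (fun x => (hJ x).hasFDerivAt) hC1

lemma IsC1Field.isBiLipschitz_flow {V : ℝ → E n → E n} {DV : ℝ → E n → E n →L[ℝ] E n} {k : ℝ → ℝ}
    (hV : IsC1Field V DV k) {T : ℝ} (hT : 0 ≤ T) : IsBiLipschitz (hV.flow 0 T) := by
  have hk : 0 ≤ ∫ t in (0 : ℝ)..T, k t :=
    intervalIntegral.integral_nonneg hT fun t _ => hV.nonneg t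
  refine ⟨Real.exp (-∫ t in (0 : ℝ)..T, k t), Real.exp (∫ t in (0 : ℝ)..T, k t), Real.exp_pos _,
    Real.exp_le_exp.2 (by linarith), fun x y => ?_⟩
  have := hV.norm_sub_le_exp_mul (hV.isIntegralCurve_flow 0 x) (hV.isIntegralCurve_flow 0 y) hT
  simp only [hV.flow_self] at this
  refine ⟨?_, this.1⟩
  rw [Real.exp_neg, inv_mul_le_iff₀ (Real.exp_pos _)]
  exact this.2

lemma IsC1Field.isFlowFromZero {V : ℝ → E n → E n} {DV : ℝ → E n → E n →L[ℝ] E n} {k : ℝ → ℝ}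
    (hV : IsC1Field V DV k) : IsFlowFromZero V (hV.flow 0) where
  init := hV.flow_self 0
  ode x := (hV.isIntegralCurve_flow 0 x).isIntegralCurveOn _
  unique _ _ γ hγ := hV.eqOn_Icc hγ ((hV.isIntegralCurve_flow 0 (γ 0)).isIntegralCurveOn _)
    (hV.flow_self 0 _).symm

/-- The probability flow transports the initial density to the density at time `T`. -/
lemma IsCb2.map_flow_toMeasure (h : IsCb2 f) (hpos : ∀ x, 0 < f x) {k : ℝ → ℝ}
    (hV : IsC1Field (heatVelocity f) (heatVelocityDeriv f) k) {T : ℝ} (hT : 0 ≤ T) :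
    (toMeasure f).map (hV.flow 0 T) = toMeasure (heatDensity f T) := by
  choose J hJ hdet using h.exists_flow_deriv hpos hV hT
  have hpT := h.heatDensity_pos hpos T
  have hJpos : ∀ x, 0 < (J x).det := fun x => by
    have h1 := hdet x
    have h2 := hpos x
    rw [← h1] at h2
    exact (mul_pos_iff_of_pos_left (hpT _)).1 h2
  refine Measure.ext_of_lintegral _ fun g hg => ?_
  have hfm : Measurable fun x => ENNReal.ofReal (f x) :=
    h.contDiff.continuous.measurable.ennreal_ofReal
  have hcm : Measurable fun x : E n => ENNReal.ofReal (heatDensity f T x) :=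
    (h.continuous_heatDensity.comp (continuous_const.prodMk continuous_id)).measurable.ennreal_ofReal
  have hφ : Measurable (hV.flow 0 T) := hV.continuous_flow.measurable
  rw [lintegral_map hg hφ, toMeasure, toMeasure,
    lintegral_withDensity_eq_lintegral_mul _ hcm hg]
  have hgφ : Measurable fun x => g (hV.flow 0 T x) := hg.comp hφ
  rw [lintegral_withDensity_eq_lintegral_mul _ hfm hgφ]
  -- The determinant is positive because both densities are, so the change of variables turns
  -- conservation of mass into the push-forward identity.
  have hcv := lintegral_image_eq_lintegral_abs_det_fderiv_mul volume MeasurableSet.univ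
    (fun x _ => (hJ x).hasFDerivAt.hasFDerivWithinAt) (hV.flowHomeomorph 0 T).injective.injOn
    (fun x => ENNReal.ofReal (heatDensity f T x) * g x)
  have himg : hV.flow 0 T '' univ = univ :=
    image_univ.trans (hV.flowHomeomorph 0 T).surjective.range_eq
  have hcv' : ∫⁻ x in hV.flow 0 T '' univ, ENNReal.ofReal (heatDensity f T x) * g x =
    ∫⁻ x in univ, ENNReal.ofReal |(J x).det| *
      (ENNReal.ofReal (heatDensity f T (hV.flow 0 T x)) * g (hV.flow 0 T x)) := hcv
  rw [himg, Measure.restrict_univ] at hcv'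
  simp only [Pi.mul_apply]
  rw [hcv']
  refine lintegral_congr fun x => ?_
  rw [abs_of_pos (hJpos x), ← mul_assoc, ← ENNReal.ofReal_mul (hJpos x).le, mul_comm (J x).det,
    hdet]

/-- The preimage of a null set under the inverse is its image under a differentiable map of `ℝⁿ`,
hence null. -/
lemma IsCb2.gaussianPullback_absolutelyContinuous (h : IsCb2 f) (hpos : ∀ x, 0 < f x)
    {k : ℝ → ℝ} (hV : IsC1Field (heatVelocity f) (heatVelocityDeriv f) k) {T : ℝ} (hT : 0 ≤ T) :
    gaussianPullback (hV.flow 0 T) ≪ volume := by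
  obtain ⟨hbij, hC1, hC1'⟩ := h.isC1Diffeo_flow hpos hV hT
  refine Measure.AbsolutelyContinuous.mk fun s hs h0 => ?_
  rw [gaussianPullback, Measure.map_apply hC1'.continuous.measurable hs]
  refine stdGaussian_absolutelyContinuous ?_
  have himg : Function.invFun (hV.flow 0 T) ⁻¹' s = hV.flow 0 T '' s := by
    ext y
    constructor
    · exact fun hy => ⟨_, hy, Function.rightInverse_invFun hbij.2 y⟩
    · rintro ⟨x, hx, rfl⟩
      rwa [mem_preimage, Function.leftInverse_invFun hbij.1]
  rw [himg]
  exact addHaar_image_eq_zero_of_differentiableOn_of_addHaar_eq_zero volume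
    (hC1.differentiable one_ne_zero).differentiableOn h0

end Transport

/-! ### Relative entropy: a Pinsker-type bound and a Gaussian estimate -/

section Divergence

open InformationTheory

/-- The pointwise form of "squared Hellinger distance is at most relative entropy": put `r = s ^ 2`
and use `1 - 1 / s ≤ log s`. -/
lemma sq_sqrt_sub_one_le_klFun {r : ℝ} (hr : 0 ≤ r) : (√r - 1) ^ 2 ≤ klFun r := by
  rcases hr.eq_or_lt with rfl | hr
  · simp [klFun_zero]
  obtain ⟨s, hs, rfl⟩ : ∃ s : ℝ, 0 < s ∧ r = s ^ 2 := ⟨√r, Real.sqrt_pos.2 hr, (Real.sq_sqrt hr.le).symm⟩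
  rw [Real.sqrt_sq hs.le, klFun_apply, Real.log_pow]
  have h1 := mul_le_mul_of_nonneg_left (Real.one_sub_inv_le_log_of_pos hs) (sq_nonneg s)
  have h2 : s ^ 2 * (1 - s⁻¹) = s ^ 2 - s := by field_simp
  push_cast
  nlinarith

/-- With `s = √r`, factor `|r - 1| = |s - 1| * (s + 1)` and apply the arithmetic-geometric
inequality with weight `δ`; the first square is bounded by `klFun`. -/
lemma abs_sub_one_le_klFun {r δ : ℝ} (hr : 0 ≤ r) (hδ : 0 < δ) :
    |r - 1| ≤ (2 * δ)⁻¹ * klFun r + δ * (r + 1) := by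
  obtain ⟨s, hs, rfl⟩ : ∃ s : ℝ, 0 ≤ s ∧ r = s ^ 2 := ⟨√r, Real.sqrt_nonneg r, (Real.sq_sqrt hr).symm⟩
  have h1 := sq_sqrt_sub_one_le_klFun hr
  rw [Real.sqrt_sq hs] at h1
  have h2 : |s ^ 2 - 1| = |s - 1| * (s + 1) := by
    rw [← abs_of_nonneg (by positivity : 0 ≤ s + 1), ← abs_mul]
    ring_nf
  have h3 : (2 * δ)⁻¹ * (s - 1) ^ 2 ≤ (2 * δ)⁻¹ * klFun (s ^ 2) := by gcongr
  have h4 : |s - 1| * (s + 1) ≤ (2 * δ)⁻¹ * (s - 1) ^ 2 + δ / 2 * (s + 1) ^ 2 := by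
    have h5 : (2 * δ)⁻¹ * (s - 1) ^ 2 + δ / 2 * (s + 1) ^ 2 - |s - 1| * (s + 1) =
        (2 * δ)⁻¹ * (|s - 1| - δ * (s + 1)) ^ 2 := by
      rw [← sq_abs (s - 1)]
      field_simp
      ring
    have h6 : 0 ≤ (2 * δ)⁻¹ * (|s - 1| - δ * (s + 1)) ^ 2 := by positivity
    linarith
  have h7 : δ / 2 * (s + 1) ^ 2 ≤ δ * (s ^ 2 + 1) := by nlinarith [sq_nonneg (s - 1)]
  linarith

/-- Convergence in relative entropy controls the `L¹` distance of densities. -/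
lemma lintegral_abs_rnDeriv_sub_one_le {α : Type*} [MeasurableSpace α] {μ ν : Measure α}
    [IsProbabilityMeasure μ] [IsProbabilityMeasure ν] {δ : ℝ} (hδ : 0 < δ)
    (hkl : klDiv μ ν ≤ ENNReal.ofReal (δ ^ 2)) :
    ∫⁻ x, ENNReal.ofReal |(μ.rnDeriv ν x).toReal - 1| ∂ν ≤ ENNReal.ofReal (3 * δ) := by
  have hac : μ ≪ ν := (klDiv_ne_top_iff.1 (ne_top_of_le_ne_top ENNReal.ofReal_ne_top hkl)).1
  have hm := Measure.measurable_rnDeriv μ ν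
  -- Integrating the pointwise bound gives `δ ^ 2 / (2 * δ) + 2 * δ`, since `r + 1` has integral
  -- `2`; this is at most `3 * δ`.
  calc ∫⁻ x, ENNReal.ofReal |(μ.rnDeriv ν x).toReal - 1| ∂ν
      ≤ ∫⁻ x, (ENNReal.ofReal (2 * δ)⁻¹ * ENNReal.ofReal (klFun (μ.rnDeriv ν x).toReal) +
          ENNReal.ofReal δ * (μ.rnDeriv ν x + 1)) ∂ν := by
        refine lintegral_mono_ae ?_
        filter_upwards [Measure.rnDeriv_lt_top μ ν] with x hx
        have hr : 0 ≤ (μ.rnDeriv ν x).toReal := ENNReal.toReal_nonneg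
        refine (ENNReal.ofReal_le_ofReal (abs_sub_one_le_klFun hr hδ)).trans_eq ?_
        rw [ENNReal.ofReal_add (mul_nonneg (by positivity) (klFun_nonneg hr)) (by positivity),
          ENNReal.ofReal_mul (by positivity), ENNReal.ofReal_mul hδ.le,
          ENNReal.ofReal_add hr zero_le_one, ENNReal.ofReal_toReal hx.ne, ENNReal.ofReal_one]
    _ = ENNReal.ofReal (2 * δ)⁻¹ * klDiv μ ν + ENNReal.ofReal δ * (1 + 1) := by
        rw [lintegral_add_right _ ((hm.add_const 1).const_mul _), lintegral_const_mul _ (by fun_prop),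
          lintegral_const_mul _ (hm.add_const 1), lintegral_add_right _ measurable_const,
          Measure.lintegral_rnDeriv hac, klDiv_eq_lintegral_klFun_of_ac hac]
        simp
    _ ≤ ENNReal.ofReal (2 * δ)⁻¹ * ENNReal.ofReal (δ ^ 2) + ENNReal.ofReal δ * ENNReal.ofReal 2 := by
        gcongr
        norm_num
    _ = ENNReal.ofReal (δ / 2 + δ * 2) := by
        rw [← ENNReal.ofReal_mul (by positivity), ← ENNReal.ofReal_mul hδ.le,
          ← ENNReal.ofReal_add (by positivity) (by positivity)]
        congr 2
        field_simp
    _ ≤ ENNReal.ofReal (3 * δ) := ENNReal.ofReal_le_ofReal (by linarith)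

variable {n : ℕ}

/-- By the chain rule for densities, `f - dν/dx = (dμ/dν - 1) * dν/dx`, so the `L¹` distance is an
integral against `ν`. -/
lemma eLpNorm_sub_rnDeriv_le {f : E n → ℝ} (hf : Continuous f) (hf0 : ∀ x, 0 ≤ f x)
    [IsProbabilityMeasure (toMeasure f)] {ν : Measure (E n)} [IsProbabilityMeasure ν]
    (hν : ν ≪ volume) {δ : ℝ} (hδ : 0 < δ)
    (hkl : klDiv (toMeasure f) ν ≤ ENNReal.ofReal (δ ^ 2)) :
    eLpNorm (fun x => f x - (ν.rnDeriv volume x).toReal) 1 volume ≤ ENNReal.ofReal (3 * δ) := by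
  have hac := (klDiv_ne_top_iff.1 (ne_top_of_le_ne_top ENNReal.ofReal_ne_top hkl)).1
  refine le_trans (le_of_eq ?_) (lintegral_abs_rnDeriv_sub_one_le hδ hkl)
  rw [eLpNorm_one_eq_lintegral_enorm, ← lintegral_rnDeriv_mul hν
    (f := fun x => ENNReal.ofReal |((toMeasure f).rnDeriv ν x).toReal - 1|) (by fun_prop)]
  refine lintegral_congr_ae ?_
  have h1 : (toMeasure f).rnDeriv volume =ᵐ[volume] fun x => ENNReal.ofReal (f x) :=
    Measure.rnDeriv_withDensity volume hf.measurable.ennreal_ofReal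
  filter_upwards [Measure.rnDeriv_mul_rnDeriv hac (κ := volume), h1,
    Measure.rnDeriv_lt_top ν volume] with x hx hx1 hx2
  rw [hx1, Pi.mul_apply] at hx
  have hfx : f x = ((toMeasure f).rnDeriv ν x).toReal * (ν.rnDeriv volume x).toReal := by
    rw [← ENNReal.toReal_mul, hx, ENNReal.toReal_ofReal (hf0 x)]
  rw [Real.enorm_eq_ofReal_abs, hfx, ← sub_one_mul, abs_mul, abs_of_nonneg ENNReal.toReal_nonneg,
    mul_comm, ENNReal.ofReal_mul ENNReal.toReal_nonneg, ENNReal.ofReal_toReal hx2.ne]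

/-- The log-density of the law of `(Y, a Y + σ Z)` with respect to that of `(Y, Z)`, for a
standard Gaussian `Z` independent of `Y`. -/
noncomputable def gaussShiftLog (a σ : ℝ) (p : E n × E n) : ℝ :=
  -(n * Real.log σ) - ‖σ⁻¹ • (p.2 - a • p.1)‖ ^ 2 / 2 + ‖p.2‖ ^ 2 / 2

lemma continuous_gaussShiftLog (a σ : ℝ) : Continuous (gaussShiftLog (n := n) a σ) := by
  unfold gaussShiftLog
  fun_prop

lemma exp_gaussShiftLog_mul (a : ℝ) {σ : ℝ} (hσ : 0 < σ) (y x : E n) :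
    Real.exp (gaussShiftLog a σ (y, x)) * gaussDensity x =
      (σ ^ n)⁻¹ * gaussDensity (σ⁻¹ • (x - a • y)) := by
  have h1 : (σ ^ n)⁻¹ = Real.exp (-(n * Real.log σ)) := by
    rw [Real.exp_neg, Real.exp_nat_mul, Real.exp_log hσ]
  rw [gaussShiftLog, gaussDensity, gaussDensity, h1, mul_left_comm, ← Real.exp_add, mul_left_comm,
    ← Real.exp_add]
  congr 2
  ring

lemma map_prod_eq_withDensity (μ : Measure (E n)) [SFinite μ] (a : ℝ) {σ : ℝ} (hσ : 0 < σ) :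
    (μ.prod (stdGaussian (E n))).map (fun p => (p.1, a • p.1 + σ • p.2)) =
      (μ.prod (stdGaussian (E n))).withDensity
        fun p => ENNReal.ofReal (Real.exp (gaussShiftLog a σ p)) := by
  have hℓ := (continuous_gaussShiftLog (n := n) a σ).measurable
  refine Measure.ext_of_lintegral _ fun g hg => ?_
  have hm : Measurable fun p : E n × E n => (p.1, a • p.1 + σ • p.2) := by fun_prop
  rw [lintegral_map hg hm, lintegral_withDensity_eq_lintegral_mul _ (by fun_prop) hg,
    lintegral_prod _ (by fun_prop), lintegral_prod _ (by simp only [Pi.mul_def]; fun_prop)]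
  refine lintegral_congr fun y => ?_
  have hgy : Measurable fun x => g (y, x) := by fun_prop
  have hgd : Measurable (gaussDensity : E n → ℝ) := continuous_gaussDensity.measurable
  rw [lintegral_stdGaussian _ (by fun_prop), lintegral_stdGaussian _ (by simp only [Pi.mul_def]; fun_prop)]
  have key := lintegral_smul_add hσ (σ⁻¹ • a • y)
    (h := fun x => ENNReal.ofReal (gaussDensity (σ⁻¹ • (x - a • y))) * g (y, x)) (by fun_prop)
  have e1 : ∀ z : E n, σ • (z + σ⁻¹ • a • y) = a • y + σ • z := fun z => by
    rw [smul_add, smul_inv_smul₀ hσ.ne', add_comm]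
  simp only [e1, add_sub_cancel_left, inv_smul_smul₀ hσ.ne'] at key
  refine key.trans ?_
  rw [← lintegral_const_mul _ (by fun_prop)]
  refine lintegral_congr fun x => ?_
  rw [Pi.mul_apply, ← mul_assoc, ← mul_assoc, ← ENNReal.ofReal_mul (by positivity),
    ← exp_gaussShiftLog_mul a hσ, mul_comm (Real.exp _), ENNReal.ofReal_mul (gaussDensity_pos x).le]

/-- Keeping the initial point as a second component can only increase the divergence, by data
processing for `Prod.snd`. For the pair, the log-density is the explicit quadratic `gaussShiftLog`,
so no entropy of `μ` enters, only its second moment. -/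
lemma klDiv_map_prod_stdGaussian_le (μ : Measure (E n)) [IsProbabilityMeasure μ]
    (hμ : Integrable (fun y => ‖y‖ ^ 2) μ) {a σ : ℝ} (ha : 0 ≤ a) (ha1 : a ≤ 1) (hσ : 0 < σ)
    (hσ1 : σ ≤ 1) :
    klDiv ((μ.prod (stdGaussian (E n))).map (fun p => a • p.1 + σ • p.2)) (stdGaussian (E n)) ≤
      ENNReal.ofReal (-(n * Real.log σ) +
        a * (∫ y, ‖y‖ ^ 2 ∂μ + ∫ z, ‖z‖ ^ 2 ∂(stdGaussian (E n)))) := by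
  set γ := stdGaussian (E n)
  set ρ := (μ.prod γ).map (fun p => (p.1, a • p.1 + σ • p.2)) with hρ
  have hm : Measurable fun p : E n × E n => (p.1, a • p.1 + σ • p.2) := by fun_prop
  have hℓ := (continuous_gaussShiftLog (n := n) a σ)
  have hρd : ρ = (μ.prod γ).withDensity fun p => ENNReal.ofReal (Real.exp (gaussShiftLog a σ p)) :=
    map_prod_eq_withDensity μ a hσ
  have : IsProbabilityMeasure ρ := Measure.isProbabilityMeasure_map hm.aemeasurable
  have hac : ρ ≪ μ.prod γ := hρd ▸ withDensity_absolutelyContinuous _ _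
  have hsnd : (μ.prod γ).map (fun p => a • p.1 + σ • p.2) = ρ.map Prod.snd := by
    rw [hρ, Measure.map_map measurable_snd hm]
    rfl
  have hsnd' : γ = (μ.prod γ).map Prod.snd := by
    rw [Measure.map_snd_prod, measure_univ, one_smul]
  have hllr : llr ρ (μ.prod γ) =ᵐ[ρ] gaussShiftLog a σ := by
    refine hac.ae_le ?_
    have h1 : ρ.rnDeriv (μ.prod γ) =ᵐ[μ.prod γ]
        fun p => ENNReal.ofReal (Real.exp (gaussShiftLog a σ p)) := by
      rw [hρd]
      exact Measure.rnDeriv_withDensity _ (by fun_prop)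
    filter_upwards [h1] with p hp
    rw [llr, hp, ENNReal.toReal_ofReal (Real.exp_pos _).le, Real.log_exp]
  have hcomp : ∀ p : E n × E n, gaussShiftLog a σ (p.1, a • p.1 + σ • p.2) =
      -(n * Real.log σ) - ‖p.2‖ ^ 2 / 2 + ‖a • p.1 + σ • p.2‖ ^ 2 / 2 := fun p => by
    simp only [gaussShiftLog, add_sub_cancel_left, inv_smul_smul₀ hσ.ne']
  have i1 : Integrable (fun p : E n × E n => ‖p.1‖ ^ 2) (μ.prod γ) := hμ.comp_fst _
  have i2 : Integrable (fun p : E n × E n => ‖p.2‖ ^ 2) (μ.prod γ) :=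
    integrable_norm_sq_stdGaussian.comp_snd _
  -- A crude bound that keeps the cross term: from `σ ≤ 1`, `a ^ 2 ≤ a` and `2 * ‖y‖ * ‖z‖ ≤ ‖y‖ ^ 2
  -- + ‖z‖ ^ 2`. Order `a` is enough, as `a` will tend to `0`.
  have hb : ∀ p : E n × E n,
      ‖a • p.1 + σ • p.2‖ ^ 2 / 2 - ‖p.2‖ ^ 2 / 2 ≤ a * (‖p.1‖ ^ 2 + ‖p.2‖ ^ 2) := fun p => by
    have h1 : ‖a • p.1 + σ • p.2‖ ≤ a * ‖p.1‖ + σ * ‖p.2‖ := by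
      refine (norm_add_le _ _).trans_eq ?_
      rw [norm_smul, norm_smul, Real.norm_of_nonneg ha, Real.norm_of_nonneg hσ.le]
    have h2 : ‖a • p.1 + σ • p.2‖ ≤ a * ‖p.1‖ + ‖p.2‖ :=
      h1.trans (by gcongr; exact mul_le_of_le_one_left (norm_nonneg _) hσ1)
    have h3 : ‖a • p.1 + σ • p.2‖ ^ 2 ≤ (a * ‖p.1‖ + ‖p.2‖) ^ 2 := by gcongr
    have h4 : a ^ 2 * ‖p.1‖ ^ 2 ≤ a * ‖p.1‖ ^ 2 := by
      gcongr
      nlinarith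
    nlinarith [mul_nonneg ha (sq_nonneg (‖p.1‖ - ‖p.2‖)), mul_nonneg ha (sq_nonneg ‖p.2‖)]
  have i3 : Integrable (fun p : E n × E n => ‖a • p.1 + σ • p.2‖ ^ 2) (μ.prod γ) := by
    refine ((((i1.add i2).const_mul a).add (i2.div_const 2)).const_mul 2).mono'
      (by fun_prop) (.of_forall fun p => ?_)
    rw [Real.norm_of_nonneg (by positivity)]
    have := hb p
    simp only [Pi.add_apply]
    linarith
  have i4 : Integrable (fun p : E n × E n => gaussShiftLog a σ (p.1, a • p.1 + σ • p.2))
      (μ.prod γ) := by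
    simp only [hcomp]
    exact ((integrable_const _).sub (i2.div_const 2)).add (i3.div_const 2)
  have i5 : Integrable (gaussShiftLog a σ) ρ :=
    (integrable_map_measure hℓ.aestronglyMeasurable hm.aemeasurable).2 i4
  have hint : ∫ p, gaussShiftLog a σ p ∂ρ ≤
      -(n * Real.log σ) + a * (∫ y, ‖y‖ ^ 2 ∂μ + ∫ z, ‖z‖ ^ 2 ∂γ) := by
    rw [integral_map hm.aemeasurable hℓ.aestronglyMeasurable]
    have e1 : ∫ p : E n × E n, ‖p.1‖ ^ 2 ∂(μ.prod γ) = ∫ y, ‖y‖ ^ 2 ∂μ := by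
      rw [integral_fun_fst (fun y : E n => ‖y‖ ^ 2)]; simp
    have e2 : ∫ p : E n × E n, ‖p.2‖ ^ 2 ∂(μ.prod γ) = ∫ z, ‖z‖ ^ 2 ∂γ := by
      rw [integral_fun_snd (fun y : E n => ‖y‖ ^ 2)]; simp
    calc ∫ p : E n × E n, gaussShiftLog a σ (p.1, a • p.1 + σ • p.2) ∂(μ.prod γ)
        ≤ ∫ p : E n × E n, (-(n * Real.log σ) + a * (‖p.1‖ ^ 2 + ‖p.2‖ ^ 2)) ∂(μ.prod γ) := by
          refine integral_mono i4 ((integrable_const _).add ((i1.add i2).const_mul a)) fun p => ?_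
          have := hb p
          simp only [hcomp]
          linarith
      _ = _ := by
          have i6 : Integrable (fun p : E n × E n => a * (‖p.1‖ ^ 2 + ‖p.2‖ ^ 2)) (μ.prod γ) :=
            (i1.add i2).const_mul a
          rw [integral_add (integrable_const _) i6, integral_const_mul, integral_add i1 i2, e1, e2]
          simp
  calc klDiv ((μ.prod γ).map (fun p => a • p.1 + σ • p.2)) γ
      = klDiv (ρ.map Prod.snd) ((μ.prod γ).map Prod.snd) := by rw [hsnd, ← hsnd']
    _ ≤ klDiv ρ (μ.prod γ) := klDiv_map_le _ _ measurable_snd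
    _ = ENNReal.ofReal (∫ p, gaussShiftLog a σ p ∂ρ) := by
        rw [klDiv_of_ac_of_integrable hac ((integrable_congr hllr).2 i5), integral_congr_ae hllr]
        simp
    _ ≤ _ := ENNReal.ofReal_le_ofReal hint

end Divergence

/-! ### Convergence to the initial density -/

section Convergence

open InformationTheory

variable {n : ℕ} {f : E n → ℝ}

lemma exp_mul_noiseScale {t : ℝ} (ht : 0 ≤ t) :
    Real.exp (-t / 2) * noiseScale t = √(1 - Real.exp (-t)) := by
  have h0 : 0 ≤ Real.exp (-t / 2) * noiseScale t :=
    mul_nonneg (Real.exp_pos _).le (Real.sqrt_nonneg _)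
  rw [← Real.sqrt_sq h0, mul_pow, noiseScale_sq ht, ← Real.exp_nat_mul, mul_sub, ← Real.exp_add]
  push_cast
  rw [mul_div_cancel₀ _ two_ne_zero, neg_add_cancel, Real.exp_zero, mul_one]

lemma integrable_norm_sq_toMeasure (hf : Continuous f) (hf0 : ∀ x, 0 ≤ f x)
    (hmoment : Integrable (fun x => ‖x‖ ^ 2 * f x) volume) :
    Integrable (fun x => ‖x‖ ^ 2) (toMeasure f) := by
  rw [toMeasure, integrable_withDensity_iff_integrable_smul' hf.measurable.ennreal_ofReal
    (ae_of_all _ fun _ => ENNReal.ofReal_lt_top)]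
  refine hmoment.congr (.of_forall fun x => ?_)
  simp only [ENNReal.toReal_ofReal (hf0 x), smul_eq_mul, mul_comm]

lemma IsCb2.klDiv_heatDensity_le (h : IsCb2 f) (hpos : ∀ x, 0 < f x)
    [IsProbabilityMeasure (toMeasure f)]
    (hmoment : Integrable (fun x => ‖x‖ ^ 2 * f x) volume) {T : ℝ} (hT : 0 < T) :
    klDiv (toMeasure (heatDensity f T)) (stdGaussian (E n)) ≤
      ENNReal.ofReal (-(n * Real.log √(1 - Real.exp (-T))) + Real.exp (-T / 2) *
        (∫ y, ‖y‖ ^ 2 ∂(toMeasure f) + ∫ z, ‖z‖ ^ 2 ∂(stdGaussian (E n)))) := by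
  have hlt : Real.exp (-T) < 1 := Real.exp_lt_one_iff.2 (by linarith)
  have hμ := integrable_norm_sq_toMeasure h.contDiff.continuous (fun x => (hpos x).le) hmoment
  refine le_trans (le_of_eq ?_) (klDiv_map_prod_stdGaussian_le _ hμ (Real.exp_pos (-T / 2)).le
    (Real.exp_le_one_iff.2 (by linarith)) (Real.sqrt_pos.2 (sub_pos.2 hlt))
    (Real.sqrt_le_one.2 (by linarith [Real.exp_pos (-T)])))
  rw [← h.map_prod_eq_toMeasure hpos T]
  simp only [smul_add, smul_smul, exp_mul_noiseScale hT.le]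

lemma tendsto_gaussian_bound (C : ℝ) :
    Tendsto (fun T : ℝ => -(n * Real.log √(1 - Real.exp (-T))) + Real.exp (-T / 2) * C)
      atTop (𝓝 0) := by
  have h1 : Tendsto (fun T : ℝ => Real.exp (-T)) atTop (𝓝 0) := Real.tendsto_exp_neg_atTop_nhds_zero
  have h2 : Tendsto (fun T : ℝ => Real.exp (-T / 2)) atTop (𝓝 0) := by
    refine (h1.comp (tendsto_id.atTop_div_const (two_pos : (0 : ℝ) < 2))).congr fun T => ?_
    simp [neg_div]
  have h3 : Tendsto (fun T : ℝ => Real.log √(1 - Real.exp (-T))) atTop (𝓝 0) := by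
    have := ((tendsto_const_nhds (x := (1 : ℝ))).sub h1).sqrt.log (by norm_num)
    simpa using this
  simpa using ((h3.const_mul (n : ℝ)).neg).add (h2.mul_const C)

lemma IsCb2.map_invFun_flow (h : IsCb2 f) (hpos : ∀ x, 0 < f x) {k : ℝ → ℝ}
    (hV : IsC1Field (heatVelocity f) (heatVelocityDeriv f) k) {T : ℝ} (hT : 0 ≤ T) :
    (toMeasure (heatDensity f T)).map (Function.invFun (hV.flow 0 T)) = toMeasure f := by
  obtain ⟨hbij, hC1, hC1'⟩ := h.isC1Diffeo_flow hpos hV hT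
  rw [← h.map_flow_toMeasure hpos hV hT,
    Measure.map_map hC1'.continuous.measurable hC1.continuous.measurable,
    Function.invFun_comp hbij.injective, Measure.map_id]

/-- The inverse flow carries the density at time `T` back to `f` and the Gaussian to its pullback,
so data processing reduces the claim to convergence of the forward process to equilibrium. -/
lemma IsCb2.tendsto_klDiv_gaussianPullback (h : IsCb2 f) (hpos : ∀ x, 0 < f x)
    [IsProbabilityMeasure (toMeasure f)]
    (hmoment : Integrable (fun x => ‖x‖ ^ 2 * f x) volume) {k : ℝ → ℝ}
    (hV : IsC1Field (heatVelocity f) (heatVelocityDeriv f) k) :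
    Tendsto (fun T => klDiv (toMeasure f) (gaussianPullback (hV.flow 0 T))) atTop (𝓝 0) := by
  have hlim := ENNReal.tendsto_ofReal (tendsto_gaussian_bound (n := n)
    (∫ y, ‖y‖ ^ 2 ∂(toMeasure f) + ∫ z, ‖z‖ ^ 2 ∂(stdGaussian (E n))))
  rw [ENNReal.ofReal_zero] at hlim
  refine tendsto_of_tendsto_of_tendsto_of_le_of_le' tendsto_const_nhds hlim
    (.of_forall fun _ => zero_le) ?_
  filter_upwards [eventually_gt_atTop 0] with T hT
  have hm := (h.isC1Diffeo_flow hpos hV hT.le).2.2.continuous.measurable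
  have : IsProbabilityMeasure (toMeasure (heatDensity f T)) :=
    h.map_flow_toMeasure hpos hV hT.le ▸
      Measure.isProbabilityMeasure_map hV.continuous_flow.aemeasurable
  calc klDiv (toMeasure f) (gaussianPullback (hV.flow 0 T))
      = klDiv ((toMeasure (heatDensity f T)).map (Function.invFun (hV.flow 0 T)))
          ((stdGaussian (E n)).map (Function.invFun (hV.flow 0 T))) := by
        rw [h.map_invFun_flow hpos hV hT.le, gaussianPullback]
    _ ≤ klDiv (toMeasure (heatDensity f T)) (stdGaussian (E n)) := klDiv_map_le _ _ hm
    _ ≤ _ := h.klDiv_heatDensity_le hpos hmoment hT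

/-- Convergence in relative entropy implies `L¹` convergence of the densities. -/
lemma tendsto_eLpNorm_sub_rnDeriv (hf : Continuous f) (hf0 : ∀ x, 0 ≤ f x)
    [IsProbabilityMeasure (toMeasure f)] {ι : Type*} {l : Filter ι} {ν : ι → Measure (E n)}
    (hν : ∀ᶠ i in l, IsProbabilityMeasure (ν i) ∧ ν i ≪ volume)
    (hkl : Tendsto (fun i => klDiv (toMeasure f) (ν i)) l (𝓝 0)) :
    Tendsto (fun i => eLpNorm (fun x => f x - ((ν i).rnDeriv volume x).toReal) 1 volume)
      l (𝓝 0) := by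
  refine ENNReal.tendsto_nhds_zero.2 fun ε hε => ?_
  obtain ⟨δ, hδ, hδε⟩ : ∃ δ : ℝ, 0 < δ ∧ ENNReal.ofReal (3 * δ) ≤ ε := by
    obtain ⟨r, hr, hrε⟩ := ENNReal.lt_iff_exists_nnreal_btwn.1 hε
    refine ⟨r / 3, by have : (0 : ℝ) < r := by exact_mod_cast hr
                      positivity, ?_⟩
    rw [mul_div_cancel₀ _ three_ne_zero, ENNReal.ofReal_coe_nnreal]
    exact hrε.le
  have hsmall : ∀ᶠ i in l, klDiv (toMeasure f) (ν i) ≤ ENNReal.ofReal (δ ^ 2) :=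
    ENNReal.tendsto_nhds_zero.1 hkl _ (ENNReal.ofReal_pos.2 (by positivity))
  filter_upwards [hν, hsmall] with i ⟨hp, hac⟩ hi
  exact (eLpNorm_sub_rnDeriv_le hf hf0 hac hδ hi).trans hδε

end Convergence

end VPFlow

theorem mainTheorem3 {n : ℕ} {Ω : Type*} [MeasurableSpace Ω] (P : Measure Ω)
    [IsProbabilityMeasure P] (X W : ℝ≥0 → Ω → VPFlow.E n) (hX : VPFlow.IsVPProcess X W P)
    (pH : VPFlow.E n → ℝ) (hlaw : HasLaw (X 0) (VPFlow.toMeasure pH) P)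
    (hmoment : Integrable (fun x => ‖x‖ ^ 2 * pH x) volume)
    (hCb : VPFlow.MemCb 2 pH) (hpos : ∀ x, 0 < pH x)
    (L : ℝ → ℝ)
    (hscore : ∀ t, 0 ≤ t → ∀ x, ‖fderiv ℝ (VPFlow.score X P t) x‖ ≤ L t)
    (hL : ∀ T, 0 < T → IntervalIntegrable (fun t => 1 + L t) volume 0 T) :
    ∃ φ : ℝ → VPFlow.E n → VPFlow.E n,
      VPFlow.IsFlowFromZero (VPFlow.velocity X P) φ ∧
      (∀ T, 0 < T → VPFlow.IsBiLipschitz (φ T) ∧ VPFlow.IsC1Diffeo (φ T)) ∧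
      Tendsto (fun T => InformationTheory.klDiv (VPFlow.toMeasure pH)
        (VPFlow.gaussianPullback (φ T))) atTop (𝓝 0) ∧
      (∀ T, 0 < T → VPFlow.gaussianPullback (φ T) ≪ volume) ∧
      Tendsto (fun T => eLpNorm (fun x => pH x -
        ((VPFlow.gaussianPullback (φ T)).rnDeriv volume x).toReal) 1 volume) atTop (𝓝 0) := by
  have h := hCb.isCb2
  have : IsProbabilityMeasure (VPFlow.toMeasure pH) := hlaw.map_eq ▸
    Measure.isProbabilityMeasure_map (hX.aemeasurable 0)
  -- Equality holds at all real times: both sides are frozen at time `0` for negative `t`.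
  have hv : VPFlow.velocity X P = VPFlow.heatVelocity pH := by
    funext t x
    rw [VPFlow.velocity, VPFlow.score_eq hX hlaw h hpos, VPFlow.heatVelocity]
  have hscore' : ∀ t, 0 ≤ t → ∀ x, ‖VPFlow.heatScoreDeriv pH t x‖ ≤ L t := fun t ht x => by
    have := hscore t ht x
    rwa [VPFlow.score_eq hX hlaw h hpos, max_eq_left ht,
      (h.hasFDerivAt_heatScore hpos t x).fderiv] at this
  have hV := h.isC1Field hpos hscore' hL
  have hkl := h.tendsto_klDiv_gaussianPullback hpos hmoment hV
  refine ⟨hV.flow 0, by rw [hv]; exact hV.isFlowFromZero, fun T hT => ⟨hV.isBiLipschitz_flow hT.le,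
    h.isC1Diffeo_flow hpos hV hT.le⟩, hkl,
    fun T hT => h.gaussianPullback_absolutelyContinuous hpos hV hT.le,
    VPFlow.tendsto_eLpNorm_sub_rnDeriv h.contDiff.continuous (fun x => (hpos x).le) ?_ hkl⟩
  filter_upwards [eventually_gt_atTop 0] with T hT
  exact ⟨Measure.isProbabilityMeasure_map
    (h.isC1Diffeo_flow hpos hV hT.le).2.2.continuous.aemeasurable,
    h.gaussianPullback_absolutelyContinuous hpos hV hT.le⟩
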